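/- Let $(\beta_p)_{p\ge 1}$ be real numbers with $\beta_p=0$ for odd $p\ge 3$ and $\sum_p p\beta_p^2<\infty$, and let $\xi(x)=\sum_{p\ge1}\beta_p^2x^p$, $\xi'(x)=\sum_{p\ge1}p\beta_p^2x^{p-1}$, $\theta(x)=x\xi'(x)-\xi(x)$ for $x\in[-1,1]$. For a measurable function $\sigma:[0,1]^4\to\{-1,+1\}$, let $\mu_\sigma$ denote the distribution of the array $s_i^l=\sigma(w,u_l,v_i,x_{i,l})$, $i,l\ge1$, where $w,(u_l),(v_i),(x_{i,l})$ are i.i.d. uniform on $[0,1]$, and let $\bar\sigma(w,u,v)=\int_0^1\sigma(w,u,v,x)\,dx$. Let $R^\infty_{l_1,\dots,l_n}=\int_0^1\bar\sigma(w,u_{l_1},v)\cdots\bar\sigma(w,u_{l_n},v)\,dv$ for $n\ge 1$, $l_1,\dots,l_n\ge1$ (the multi-overlaps; for $n=2$ the overlaps $R^\infty_{l,l'}$). Given $\bar\sigma$, put $Q_w(u,u')=\int_0^1\bar\sigma(w,u,v)\bar\sigma(w,u',v)\,dv$. For each $w$ let $(g_i(w,u))_{u\in[0,1]}$, $i\ge1$,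 and $(h_k(w,u))_{u\in[0,1]}$, $k\ge1$, be independent centered Gaussian processes with covariances $\xi'(Q_w(u,u'))$ and $\theta(Q_w(u,u'))$ respectively, realized jointly measurably in $(w,u)$ and the randomness and independently of $w,(u_l),(v_i)$. With independent standard Gaussian variables $(z_i),(z_k')$, independent of everything else, let $$G_{\xi',i}=g_i(w,u)+z_i\bigl(\xi'(1)-\xi'(Q_w(u,u))\bigr)^{1/2},\qquad G_{\theta,k}=h_k(w,u)+z_k'\bigl(\theta(1)-\theta(Q_w(u,u))\bigr)^{1/2}.$$ Let $\mathbb E'$ be the expectation in $u,(z_i),(z'_k)$ only ($u$ uniform on $[0,1]$), $\mathcal E_{n,r}=\exp\bigl(\sum_{i\le n}\log\operatorname{ch}G_{\xi',i}+\sum_{k\le r}G_{\theta,k}\bigr)$, $V=\mathbb E'\mathcal E_{n,r}$ and, for sets $C_1,\dots,C_q\subseteq\{1,\dots,m\}$, $$U_l=\mathbb E'\prod_{i\in C_l,\,i\le n}\operatorname{th}G_{\xi',i}\prod_{i\in C_l,\,i>n}\bar\sigma(w,u,v_i)\;\mathcal E_{n,r}.$$ Let $\mathcal M_{inv}$ be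 the set of the distributions $\mu_\sigma$ for those $\sigma$ that satisfy $$\mathbb E\prod_{l\le q}\mathbb E'\prod_{i\in C_l}\bar\sigma(w,u,v_i)=\mathbb E\,\frac{\prod_{l\le q}U_l}{V^q}$$ for all $n,m,q,r\ge1$ with $n\le m$ and all $C_1,\dots,C_q\subseteq\{1,\dots,m\}$ (the right-hand side does not depend on the realization of the Gaussian processes). Theorem. For $\mu\in\mathcal M_{inv}$, the joint distribution of the overlaps $(R^\infty_{l,l'})_{l,l'\ge1}$ uniquely determines $\mu$ within $\mathcal M_{inv}$, and thus the joint distribution of all multi-overlaps. That is, if $\mu,\nu\in\mathcal M_{inv}$, if $\sigma,\tau:[0,1]^4\to\{-1,+1\}$ are any measurable functions with $\mu=\mu_\sigma$ and $\nu=\mu_\tau$, and if the arrays of overlaps $(R^\infty_{l,l'})_{l,l'\ge1}$ defined by $\bar\sigma$ and by $\bar\tau$ have the same distribution, then $\mu=\nu$, and the families of all multi-overlaps $(R^\infty_{l_1,\dots,l_n})_{n\ge1,\,l_1,\dots,l_n\ge1}$ defined by $\bar\sigma$ and by $\bar\tau$ have the same distribution. -/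

import Mathlib

noncomputable section

open MeasureTheory ProbabilityTheory

namespace SKModel

/-- The unit interval `[0,1]`, with Lebesgue measure as its `volume`. -/
abbrev I : Type := unitInterval

/-! ### The covariance functions of the mixed `p`-spin model -/

/-- `ξ(x) = ∑_{p ≥ 1} β_p² x^p` (the summation index is `p - 1`; `β 0` plays no role). -/
def xi (β : ℕ → ℝ) (x : ℝ) : ℝ := ∑' p : ℕ, β (p + 1) ^ 2 * x ^ (p + 1)

/-- `ξ'(x) = ∑_{p ≥ 1} p β_p² x^{p-1}`, the derivative of `ξ`, written as a power series so that it
is also the right object at the endpoints `x = ±1`. -/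
def xiDeriv (β : ℕ → ℝ) (x : ℝ) : ℝ := ∑' p : ℕ, ((p : ℝ) + 1) * β (p + 1) ^ 2 * x ^ p

/-- `θ(x) = x ξ'(x) - ξ(x)`. -/
def theta (β : ℕ → ℝ) (x : ℝ) : ℝ := x * xiDeriv β x - xi β x

/-- The parameters `β_p` of a mixed `p`-spin Hamiltonian: only `p = 1` and even `p ≥ 2` occur, and
`ξ'(1) = ∑ p β_p²` is finite. -/
structure IsMixture (β : ℕ → ℝ) : Prop where
  odd_eq_zero : ∀ p : ℕ, Odd p → p ≠ 1 → β p = 0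
  summable : Summable fun p : ℕ => (p : ℝ) * β p ^ 2

/-! ### Exchangeable spin arrays and (multi-)overlaps -/

/-- The law of an i.i.d. family of uniform random variables on `[0,1]`, indexed by `ι`. -/
def uniformSeq (ι : Type) : Measure (ι → I) := Measure.infinitePi fun _ : ι => (volume : Measure I)

/-- The law of a sequence of i.i.d. standard Gaussian random variables. -/
def gaussianSeq : Measure (ℕ → ℝ) := Measure.infinitePi fun _ : ℕ => gaussianReal 0 1

/-- A measurable function `σ : [0,1]⁴ → {-1,+1}`. -/
structure IsSpinFunction (σ : I → I → I → I → ℝ) : Prop where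
  measurable : Measurable fun p : I × I × I × I => σ p.1 p.2.1 p.2.2.1 p.2.2.2
  eq_or_eq : ∀ w u v x, σ w u v x = -1 ∨ σ w u v x = 1

/-- The law of the array `s i l = σ(w, u_l, v_i, x_{i,l})`, with `w`, `(u_l)`, `(v_i)`, `(x_{i,l})`
i.i.d. uniform on `[0,1]`. -/
def arrayLaw (σ : I → I → I → I → ℝ) : Measure (ℕ → ℕ → ℝ) :=
  Measure.map
    (fun p : I × (ℕ → I) × (ℕ → I) × (ℕ × ℕ → I) =>
      fun i l => σ p.1 (p.2.1 l) (p.2.2.1 i) (p.2.2.2 (i, l)))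
    ((volume : Measure I).prod
      ((uniformSeq ℕ).prod ((uniformSeq ℕ).prod (uniformSeq (ℕ × ℕ)))))

/-- `σ` is a spin function that generates the distribution `μ` of an exchangeable array. -/
def Represents (σ : I → I → I → I → ℝ) (μ : Measure (ℕ → ℕ → ℝ)) : Prop :=
  IsSpinFunction σ ∧ arrayLaw σ = μ

/-- `σ̄(w,u,v) = 𝔼_x σ(w,u,v,x)`. -/
def bar (σ : I → I → I → I → ℝ) (w u v : I) : ℝ := ∫ x : I, σ w u v x

/-- `𝔼_v σ̄(w,u,v) σ̄(w,u',v)`. -/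
def overlap (s : I → I → I → ℝ) (w u u' : I) : ℝ := ∫ v : I, s w u v * s w u' v

/-- The joint law of the overlaps `R_{l,l'} = 𝔼_v σ̄(w,u_l,v) σ̄(w,u_{l'},v)` for all `l, l'`. -/
def overlapLaw (s : I → I → I → ℝ) : Measure (ℕ × ℕ → ℝ) :=
  Measure.map (fun (p : I × (ℕ → I)) (a : ℕ × ℕ) => overlap s p.1 (p.2 a.1) (p.2 a.2))
    ((volume : Measure I).prod (uniformSeq ℕ))

/-- The joint law of all multi-overlaps `R_{l_1,…,l_n} = 𝔼_v σ̄(w,u_{l_1},v) ⋯ σ̄(w,u_{l_n},v)`, for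
all `n ≥ 1` and all `l_1, …, l_n`; an index `⟨k, l⟩` stands for a tuple of length `n = k + 1`. -/
def multiOverlapLaw (s : I → I → I → ℝ) : Measure ((Σ k : ℕ, (Fin (k + 1) → ℕ)) → ℝ) :=
  Measure.map
    (fun (p : I × (ℕ → I)) (a : Σ k : ℕ, (Fin (k + 1) → ℕ)) =>
      ∫ v : I, ∏ j : Fin (a.1 + 1), s p.1 (p.2 (a.2 j)) v)
    ((volume : Measure I).prod (uniformSeq ℕ))

/-! ### The Gaussian fields -/

/-- `g 0, g 1, …` and `h 0, h 1, …` are, for every `w`, independent centered Gaussian processes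
indexed by `u ∈ [0,1]`; the `g i` have covariance `ξ'(𝔼_v σ̄(w,u,v) σ̄(w,u',v))` and the `h k` have
covariance `θ(𝔼_v σ̄(w,u,v) σ̄(w,u',v))`. They are jointly measurable in `(w, u, ω)`, so that they can
be integrated in `u` and `w`. -/
structure IsFieldFamily {Ω : Type} [MeasurableSpace Ω] (P : Measure Ω) (β : ℕ → ℝ)
    (s : I → I → I → ℝ) (g h : ℕ → I → I → Ω → ℝ) : Prop where
  measurable_g : ∀ i, Measurable fun p : I × I × Ω => g i p.1 p.2.1 p.2.2
  measurable_h : ∀ k, Measurable fun p : I × I × Ω => h k p.1 p.2.1 p.2.2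
  gaussian_g : ∀ i w, IsGaussianProcess (fun u : I => g i w u) P
  gaussian_h : ∀ k w, IsGaussianProcess (fun u : I => h k w u) P
  mean_g : ∀ i w u, ∫ ω, g i w u ω ∂P = 0
  mean_h : ∀ k w u, ∫ ω, h k w u ω ∂P = 0
  cov_g : ∀ i w u u', cov[g i w u, g i w u'; P] = xiDeriv β (overlap s w u u')
  cov_h : ∀ k w u u', cov[h k w u, h k w u'; P] = theta β (overlap s w u u')
  indep : ∀ w, iIndepFun (fun (j : ℕ ⊕ ℕ) (ω : Ω) (u : I) => Sum.elim g h j w u ω) P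

/-- `G_{ξ'}(σ̄(w,u,·)) = g(σ̄(w,u,·)) + z (ξ'(1) - ξ'(𝔼_v σ̄(w,u,v)²))^{1/2}`, where `y` is the value
of `g(σ̄(w,u,·))`. -/
def fieldXi (β : ℕ → ℝ) (s : I → I → I → ℝ) (w u : I) (y z : ℝ) : ℝ :=
  y + z * Real.sqrt (xiDeriv β 1 - xiDeriv β (overlap s w u u))

/-- `G_θ(σ̄(w,u,·)) = h(σ̄(w,u,·)) + z' (θ(1) - θ(𝔼_v σ̄(w,u,v)²))^{1/2}`, where `y` is the value of
`h(σ̄(w,u,·))`. -/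
def fieldTheta (β : ℕ → ℝ) (s : I → I → I → ℝ) (w u : I) (y z' : ℝ) : ℝ :=
  y + z' * Real.sqrt (theta β 1 - theta β (overlap s w u u))

/-- The law of the replica variables `(u, (z_i), (z'_k))`: integration against it is `𝔼'`. -/
def replicaMeasure : Measure (I × (ℕ → ℝ) × (ℕ → ℝ)) :=
  (volume : Measure I).prod (gaussianSeq.prod gaussianSeq)

/-- The density
`𝓔_{n,r} = exp (∑_{i ≤ n} log ch G_{ξ',i}(σ̄(w,u,·)) + ∑_{k ≤ r} G_{θ,k}(σ̄(w,u,·)))`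
as a function of `(u, z, z')`. -/
def density {Ω : Type} (β : ℕ → ℝ) (s : I → I → I → ℝ) (g h : ℕ → I → I → Ω → ℝ) (n r : ℕ)
    (w : I) (ω : Ω) (ρ : I × (ℕ → ℝ) × (ℕ → ℝ)) : ℝ :=
  Real.exp
    (∑ i ∈ Finset.range n, Real.log (Real.cosh (fieldXi β s w ρ.1 (g i w ρ.1 ω) (ρ.2.1 i)))
      + ∑ k ∈ Finset.range r, fieldTheta β s w ρ.1 (h k w ρ.1 ω) (ρ.2.2 k))

/-- `U = 𝔼' ∏_{i ∈ C, i ≤ n} th G_{ξ',i}(σ̄(w,u,·)) ∏_{i ∈ C, i > n} σ̄(w,u,v_i) 𝓔_{n,r}`; coordinates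
are numbered from `0`, so that `i ≤ n` reads `i < n`. -/
def numerU {Ω : Type} (β : ℕ → ℝ) (s : I → I → I → ℝ) (g h : ℕ → I → I → Ω → ℝ) (n r : ℕ)
    (C : Finset ℕ) (w : I) (v : ℕ → I) (ω : Ω) : ℝ :=
  ∫ ρ : I × (ℕ → ℝ) × (ℕ → ℝ),
    (∏ i ∈ C with i < n, Real.tanh (fieldXi β s w ρ.1 (g i w ρ.1 ω) (ρ.2.1 i)))
      * (∏ i ∈ C with n ≤ i, s w ρ.1 (v i)) * density β s g h n r w ω ρ ∂replicaMeasure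

/-- `V = 𝔼' 𝓔_{n,r}`. -/
def denomV {Ω : Type} (β : ℕ → ℝ) (s : I → I → I → ℝ) (g h : ℕ → I → I → Ω → ℝ) (n r : ℕ)
    (w : I) (ω : Ω) : ℝ :=
  ∫ ρ : I × (ℕ → ℝ) × (ℕ → ℝ), density β s g h n r w ω ρ ∂replicaMeasure

/-! ### The invariance equations -/

/-- The invariance and self-consistency equations for `σ̄`: for all `n, m, q, r ≥ 1` with `n ≤ m` and
all subsets `C_1, …, C_q` of the first `m` coordinates,
`𝔼 ∏_{l ≤ q} 𝔼' ∏_{i ∈ C_l} σ̄(w,u,v_i) = 𝔼 (∏_{l ≤ q} U_l) / V^q`.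
The right-hand side does not depend on the realization of the Gaussian fields. -/
def Invariant (β : ℕ → ℝ) (s : I → I → I → ℝ) : Prop :=
  ∃ (Ω : Type) (_ : MeasurableSpace Ω) (P : Measure Ω) (g h : ℕ → I → I → Ω → ℝ),
    IsProbabilityMeasure P ∧ IsFieldFamily P β s g h ∧
    ∀ n m q r : ℕ, 1 ≤ n → 1 ≤ m → 1 ≤ q → 1 ≤ r → n ≤ m →
      ∀ C : Fin q → Finset ℕ, (∀ l, C l ⊆ Finset.range m) →
        ∫ p : I × (ℕ → I), ∏ l : Fin q, (∫ u : I, ∏ i ∈ C l, s p.1 u (p.2 i))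
            ∂((volume : Measure I).prod (uniformSeq ℕ))
          = ∫ p : I × (ℕ → I) × Ω,
              (∏ l : Fin q, numerU β s g h n r (C l) p.1 p.2.1 p.2.2)
                / denomV β s g h n r p.1 p.2.2 ^ q
              ∂((volume : Measure I).prod ((uniformSeq ℕ).prod P))

/-- `𝓜_inv`: the distributions of exchangeable arrays generated by spin functions `σ` for which `σ̄`
satisfies the invariance equations. -/
def MInv (β : ℕ → ℝ) : Set (Measure (ℕ → ℕ → ℝ)) :=
  {μ | ∃ σ : I → I → I → I → ℝ, Represents σ μ ∧ Invariant β (bar σ)}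

end SKModel

end

/-! In the invariance equations take `n = m`. The factors `σ̄(w,u,v_i)` then disappear from the
right-hand side, and `U_l` and `V` are averages over one replica `(u,z,z')` of functions of the
Gaussian fields alone. For fixed `w` and `ω` the strong law of large numbers makes them limits of
empirical averages over i.i.d. replicas. The empirical ratio is bounded by 1, so the right-hand side
is a limit of expectations of functions of the fields of finitely many replicas
(`IsFieldFamily.tendsto_integral_empiricalRatio`). Given `w`, the `u_l` and the noises, these fields
are Gaussian with covariances `ξ'(R_{l,l'})` and `θ(R_{l,l'})`, and the noises enter with
coefficients that depend on `R_{l,l}`. Their conditional characteristic function therefore sees the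
overlaps only, and the law of the overlaps fixes the law of the fields (`fieldArrayLaw_eq`). The
left-hand side is the density in `σ̄` of a simple bipartite graph joining replicas to sites, that
is, a joint moment of distinct spins. Since spins square to one, these moments determine the law of
the array (`arrayLaw_eq_of_homDensity`).

It remains to see that the law of the array determines the law of all multi-overlaps. This is also
needed because the invariance equations may hold for other representing functions than those whose
overlaps are compared. Moments of multi-overlaps are densities of multigraphs (already `R_{l,l}` has
a double edge), whereas moments of spins give densities of simple graphs only. The bridge is
`homDensity_eq_of_nodup`. For fixed `w`, regard `s = σ̄` as the kernel of an operator of norm at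
most one; then `(1 - s sᵀ)^k s` tends to zero in mean
(`tendsto_one_sub_adjoint_comp_self_pow_apply`). Replacing a factor `s` by `s sᵀ s` replaces an edge
by a path of three edges through two new vertices. Up to a vanishing error, a repeated edge is thus
a combination of longer paths without repeated edges, and the repetitions can be removed one at a
time. -/

namespace SKModel

open MeasureTheory ProbabilityTheory Filter
open scoped Topology

/-! ### Infinite product measures -/

section ProductMeasure

variable {ι : Type*} {X : Type*} [MeasurableSpace X]

theorem integral_infinitePi_prod (μ : Measure X) [IsProbabilityMeasure μ] (S : Finset ι)
    {φ : ι → X → ℝ} (hφ : ∀ i, Measurable (φ i)) :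
    ∫ x : ι → X, ∏ i ∈ S, φ i (x i) ∂(Measure.infinitePi fun _ => μ) = ∏ i ∈ S, ∫ y, φ i y ∂μ := by
  have h := (iIndepFun_infinitePi (P := fun _ : ι => μ) hφ).precomp
    (Subtype.val_injective (p := fun i => i ∈ S))
  have h' := h.integral_fun_prod_eq_prod_integral
    (fun i => ((hφ i).comp (measurable_pi_apply _)).aestronglyMeasurable)
  rw [Finset.prod_coe_sort S (fun i => ∫ x : ι → X, φ i (x i) ∂(Measure.infinitePi fun _ => μ))] at h'
  simp_rw [fun x : ι → X => Finset.prod_coe_sort S (fun i => φ i (x i))] at h'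
  rw [h']
  refine Finset.prod_congr rfl fun i _ => ?_
  have := integral_map (μ := Measure.infinitePi fun _ : ι => μ) (φ := fun x => x i) (f := φ i)
    (measurable_pi_apply i).aemeasurable (hφ i).aestronglyMeasurable
  rw [Measure.infinitePi_map_eval] at this
  exact this.symm

variable [DecidableEq ι]

/-- On a box, the old sequence is constrained only off `N` and the new value only at `N`, so the
mass factorizes as before. This is what later allows one vertex of a graph to be averaged alone. -/
theorem map_update_infinitePi (μ : Measure X) [IsProbabilityMeasure μ] (N : ι) :
    ((Measure.infinitePi fun _ : ι => μ).prod μ).map (fun p => Function.update p.1 N p.2)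
      = Measure.infinitePi fun _ : ι => μ := by
  refine Measure.eq_infinitePi _ fun s t ht => ?_
  have hm : Measurable fun p : (ι → X) × X => Function.update p.1 N p.2 := measurable_update'
  rw [Measure.map_apply hm (.pi s.countable_toSet fun _ _ => ht _)]
  have : (fun p : (ι → X) × X => Function.update p.1 N p.2) ⁻¹' ((s : Set ι).pi t)
      = ((s.erase N : Finset ι) : Set ι).pi t ×ˢ (if N ∈ s then t N else Set.univ) := by
    ext ⟨x, y⟩
    simp only [Set.mem_preimage, Set.mem_pi, Finset.mem_coe, Set.mem_prod, Finset.mem_erase]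
    constructor
    · intro h
      refine ⟨fun i hi => by simpa [hi.1] using h i hi.2, ?_⟩
      split_ifs with hN
      · simpa using h N hN
      · trivial
    · rintro ⟨h1, h2⟩ i hi
      by_cases hiN : i = N
      · subst hiN; simpa [hi] using h2
      · simpa [hiN] using h1 i ⟨hiN, hi⟩
  rw [this, Measure.prod_prod, Measure.infinitePi_pi _ fun i _ => ht i]
  split_ifs with hN
  · rw [Finset.prod_erase_mul _ _ hN]
  · rw [measure_univ, mul_one, Finset.erase_eq_of_notMem hN]

theorem integral_infinitePi_update (μ : Measure X) [IsProbabilityMeasure μ] (N : ι)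
    {Φ : (ι → X) → ℝ} (hΦ : Measurable Φ) {c : ℝ} (hb : ∀ x, |Φ x| ≤ c) :
    ∫ x, Φ x ∂(Measure.infinitePi fun _ : ι => μ)
      = ∫ x, ∫ y, Φ (Function.update x N y) ∂μ ∂(Measure.infinitePi fun _ : ι => μ) := by
  have hm : Measurable fun p : (ι → X) × X => Function.update p.1 N p.2 := measurable_update'
  conv_lhs => rw [← map_update_infinitePi μ N]
  rw [integral_map hm.aemeasurable hΦ.aestronglyMeasurable, integral_prod]
  exact Integrable.of_bound (hΦ.comp hm).aestronglyMeasurable c (ae_of_all _ fun p => hb _)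

end ProductMeasure

/-- Fubini and independence of the coordinates give both laws the same mass on boxes. It joins the
`u_l` and the Gaussian noises into one i.i.d. sequence of replicas. -/
theorem map_zip_infinitePi {ι X Y : Type*} [MeasurableSpace X] [MeasurableSpace Y]
    (μ : Measure X) (ν : Measure Y) [IsProbabilityMeasure μ] [IsProbabilityMeasure ν] :
    ((Measure.infinitePi fun _ : ι => μ).prod (Measure.infinitePi fun _ : ι => ν)).map
        (fun p i => (p.1 i, p.2 i))
      = Measure.infinitePi fun _ : ι => μ.prod ν := by
  refine Measure.eq_infinitePi _ fun s t ht => ?_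
  have hm : Measurable fun (p : (ι → X) × (ι → Y)) (i : ι) => (p.1 i, p.2 i) := by fun_prop
  have hS : MeasurableSet ((s : Set ι).pi t) := .pi s.countable_toSet fun _ _ => ht _
  rw [Measure.map_apply hm hS, Measure.prod_apply (hm hS)]
  have : ∀ x : ι → X, (Measure.infinitePi fun _ : ι => ν)
      (Prod.mk x ⁻¹' ((fun (p : (ι → X) × (ι → Y)) (i : ι) => (p.1 i, p.2 i)) ⁻¹' ((s : Set ι).pi t)))
      = ∏ i ∈ s, ν (Prod.mk (x i) ⁻¹' t i) := by
    intro x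
    rw [← Measure.infinitePi_pi (fun _ : ι => ν) (s := s) (t := fun i => Prod.mk (x i) ⁻¹' t i)
      (fun i _ => measurable_prodMk_left (ht i))]
    rfl
  simp_rw [this]
  have hmi : ∀ i, Measurable fun x : X => ν (Prod.mk x ⁻¹' t i) := fun i =>
    measurable_measure_prodMk_left (ht i)
  rw [lintegral_prod_eq_prod_lintegral_of_indepFun s
    (fun i (x : ι → X) => ν (Prod.mk (x i) ⁻¹' t i)) (iIndepFun_infinitePi (P := fun _ : ι => μ) hmi)
    (fun i => (hmi i).comp (measurable_pi_apply i))]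
  refine Finset.prod_congr rfl fun i _ => ?_
  rw [Measure.prod_apply (ht i)]
  have := lintegral_map (μ := Measure.infinitePi fun _ : ι => μ) (hmi i) (measurable_pi_apply i)
  rw [Measure.infinitePi_map_eval] at this
  exact this.symm

/-! ### Characteristic functions and moments determine measures -/

section Uniqueness

variable {ι : Type*} [Countable ι]

/-- Finite-dimensional marginals determine the measure, characteristic functions determine the
marginals, and a linear functional on finitely many coordinates is a list of coefficients. -/
theorem measure_ext_of_charFun {μ ν : Measure (ι → ℝ)} [IsFiniteMeasure μ] [IsFiniteMeasure ν]
    (h : ∀ (S : Finset ι) (t : ι → ℝ),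
      ∫ x, Complex.exp ((∑ i ∈ S, t i * x i : ℝ) * Complex.I) ∂μ
        = ∫ x, Complex.exp ((∑ i ∈ S, t i * x i : ℝ) * Complex.I) ∂ν) : μ = ν := by
  classical
  refine IsProjectiveLimit.unique (P := fun S : Finset ι => ν.map S.restrict) (fun S => ?_)
    (fun S => rfl)
  refine Measure.ext_of_charFunDual ?_
  ext L
  rw [charFunDual_apply, charFunDual_apply,
    integral_map (S.measurable_restrict).aemeasurable
      (Continuous.aestronglyMeasurable (by fun_prop)),
    integral_map (S.measurable_restrict).aemeasurable
      (Continuous.aestronglyMeasurable (by fun_prop))]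
  have hL : ∀ x : ι → ℝ, L (S.restrict x)
      = ∑ i ∈ S, (if hi : i ∈ S then L (Pi.single ⟨i, hi⟩ 1) else 0) * x i := by
    intro x
    rw [← Finset.sum_coe_sort S]
    conv_lhs => rw [← Finset.univ_sum_single (S.restrict x), map_sum]
    refine Finset.sum_congr rfl fun i _ => ?_
    have : (Pi.single i (S.restrict x i) : S → ℝ) = x i • Pi.single i 1 := by
      rw [← Pi.single_smul]; simp
    rw [this, map_smul, smul_eq_mul, dif_pos i.2, mul_comm]
  simp_rw [hL]
  exact h S _

/-- The coordinates separate the points of the cube, so the algebra they generate determines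
measures; that algebra is spanned by monomials. -/
theorem measure_ext_of_moments_cube {μ ν : Measure (ι → Set.Icc (-1 : ℝ) 1)}
    [IsFiniteMeasure μ] [IsFiniteMeasure ν]
    (h : ∀ L : List ι, ∫ x, (L.map fun i => (x i : ℝ)).prod ∂μ
      = ∫ x, (L.map fun i => (x i : ℝ)).prod ∂ν) : μ = ν := by
  let coord : ι → BoundedContinuousFunction (ι → Set.Icc (-1 : ℝ) 1) ℝ := fun i =>
    BoundedContinuousFunction.mkOfCompact ⟨fun x => (x i : ℝ), by fun_prop⟩
  have hc : ∀ i x, coord i x = x i := fun i x => rfl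
  let A : StarSubalgebra ℝ (BoundedContinuousFunction (ι → Set.Icc (-1 : ℝ) 1) ℝ) :=
    { Algebra.adjoin ℝ (Set.range coord) with
      star_mem' := fun {a} ha => by
        have : star a = a := by ext; simp
        rwa [this] }
  refine ext_of_forall_mem_subalgebra_integral_eq_of_polish (𝕜 := ℝ) (A := A) ?_ ?_
  · intro x y hxy
    obtain ⟨i, hi⟩ := Function.ne_iff.1 hxy
    refine ⟨coord i, ⟨_, ⟨coord i, Algebra.subset_adjoin ⟨i, rfl⟩, rfl⟩, rfl⟩, ?_⟩
    rw [hc, hc]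
    exact fun h => hi (Subtype.ext h)
  · intro g hg
    have hg' : g ∈ Submodule.span ℝ (Submonoid.closure (Set.range coord) : Set _) := by
      rw [← Algebra.adjoin_eq_span]; exact hg
    clear hg
    induction hg' using Submodule.span_induction with
    | mem g hg =>
      obtain ⟨l, hl, rfl⟩ := Submonoid.exists_list_of_mem_closure hg
      obtain ⟨L, rfl⟩ : ∃ L : List ι, l = L.map coord := by
        clear h hg
        induction l with
        | nil => exact ⟨[], rfl⟩
        | cons a l ih =>
          obtain ⟨L, rfl⟩ := ih (fun y hy => hl y (List.mem_cons_of_mem _ hy))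
          obtain ⟨i, rfl⟩ := hl a List.mem_cons_self
          exact ⟨i :: L, rfl⟩
      have : ∀ x, (L.map coord).prod x = (L.map fun i => (x i : ℝ)).prod := by
        intro x
        clear hl hg
        induction L with
        | nil => simp
        | cons i L ih => simp [ih, hc]
      simp_rw [this]
      exact h L
    | zero => simp
    | add f g _ _ hf hg =>
      simp only [BoundedContinuousFunction.coe_add, Pi.add_apply]
      rw [integral_add (f.integrable μ) (g.integrable μ),
        integral_add (f.integrable ν) (g.integrable ν), hf, hg]
    | smul c f _ hf =>
      simp only [BoundedContinuousFunction.coe_smul, smul_eq_mul]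
      rw [integral_const_mul, integral_const_mul, hf]

/-- Both measures live on the cube, hence are recovered from their images under the coordinatewise
projection `c` onto it. -/
theorem measure_ext_of_moments {μ ν : Measure (ι → ℝ)} [IsFiniteMeasure μ] [IsFiniteMeasure ν]
    (hμ : ∀ᵐ x ∂μ, ∀ i, |x i| ≤ 1) (hν : ∀ᵐ x ∂ν, ∀ i, |x i| ≤ 1)
    (h : ∀ L : List ι, ∫ x, (L.map x).prod ∂μ = ∫ x, (L.map x).prod ∂ν) : μ = ν := by
  let c : (ι → ℝ) → ι → Set.Icc (-1 : ℝ) 1 := fun x i => Set.projIcc (-1) 1 (by norm_num) (x i)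
  let e : (ι → Set.Icc (-1 : ℝ) 1) → ι → ℝ := fun x i => x i
  have hc : Measurable c := measurable_pi_lambda _ fun i =>
    (continuous_projIcc.measurable).comp (measurable_pi_apply i)
  have he : Measurable e := measurable_pi_lambda _ fun i =>
    measurable_subtype_coe.comp (measurable_pi_apply i)
  have hec : ∀ x : ι → ℝ, (∀ i, |x i| ≤ 1) → e (c x) = x := fun x hx => by
    ext i
    have : x i ∈ Set.Icc (-1 : ℝ) 1 := abs_le.1 (hx i)
    simp only [e, c, Set.projIcc_of_mem _ this]
  have key : ∀ ρ : Measure (ι → ℝ), (∀ᵐ x ∂ρ, ∀ i, |x i| ≤ 1) → (ρ.map c).map e = ρ := by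
    intro ρ hρ
    rw [Measure.map_map he hc]
    conv_rhs => rw [← Measure.map_id (μ := ρ)]
    exact Measure.map_congr (by filter_upwards [hρ] with x hx using hec x hx)
  rw [← key μ hμ, ← key ν hν]
  congr 1
  refine measure_ext_of_moments_cube fun L => ?_
  have hm : Measurable fun x : ι → Set.Icc (-1 : ℝ) 1 => (L.map fun i => (x i : ℝ)).prod := by
    induction L with
    | nil => simp
    | cons i L ih =>
      simp only [List.map_cons, List.prod_cons]
      exact (measurable_subtype_coe.comp (measurable_pi_apply i)).mul ih
  rw [integral_map hc.aemeasurable hm.aestronglyMeasurable,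
    integral_map hc.aemeasurable hm.aestronglyMeasurable]
  have : ∀ ρ : Measure (ι → ℝ), (∀ᵐ x ∂ρ, ∀ i, |x i| ≤ 1) →
      ∫ x, (L.map fun i => (c x i : ℝ)).prod ∂ρ = ∫ x, (L.map x).prod ∂ρ := by
    intro ρ hρ
    refine integral_congr_ae ?_
    filter_upwards [hρ] with x hx
    have := hec x hx
    congr 2
  rw [this μ hμ, this ν hν, h L]

end Uniqueness

/-! ### Powers of `1 - B*B` for a contraction `B` -/

section HilbertSpace

theorem norm_pow_apply_le {H : Type*} [NormedAddCommGroup H] [NormedSpace ℝ H] {T : H →L[ℝ] H}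
    (hT : ∀ y, ‖T y‖ ≤ ‖y‖) (k : ℕ) (y : H) : ‖(T ^ k) y‖ ≤ ‖y‖ := by
  induction k with
  | zero => simp
  | succ k ih => rw [pow_succ']; exact (hT _).trans ih

variable {H G : Type*} [NormedAddCommGroup H] [InnerProductSpace ℝ H] [CompleteSpace H]
  [NormedAddCommGroup G] [InnerProductSpace ℝ G] [CompleteSpace G]

-- Expand the square: the cross term is `-2‖B y‖²` and the last term is at most `‖B y‖²`. The loss
-- of `‖B y‖²` at each application is what forces convergence below.
open ContinuousLinearMap in
theorem norm_one_sub_adjoint_comp_self_apply_sq_le {B : H →L[ℝ] G} (hB : ‖B‖ ≤ 1) (y : H) :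
    ‖(1 - adjoint B ∘L B) y‖ ^ 2 ≤ ‖y‖ ^ 2 - ‖B y‖ ^ 2 := by
  have h1 : ‖adjoint B (B y)‖ ≤ ‖B y‖ := by
    refine (le_opNorm _ _).trans ?_
    rw [LinearIsometryEquiv.norm_map]
    exact mul_le_of_le_one_left (norm_nonneg _) hB
  have h2 : inner ℝ y (adjoint B (B y)) = ‖B y‖ ^ 2 := by
    rw [adjoint_inner_right, real_inner_self_eq_norm_sq]
  have h3 : ‖y - adjoint B (B y)‖ ^ 2 = ‖y‖ ^ 2 - 2 * ‖B y‖ ^ 2 + ‖adjoint B (B y)‖ ^ 2 := by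
    rw [norm_sub_sq_real, h2]
  have h4 : ‖adjoint B (B y)‖ ^ 2 ≤ ‖B y‖ ^ 2 := by gcongr
  change ‖y - adjoint B (B y)‖ ^ 2 ≤ _
  linarith

open ContinuousLinearMap in
theorem norm_one_sub_adjoint_comp_self_apply_le {B : H →L[ℝ] G} (hB : ‖B‖ ≤ 1) (y : H) :
    ‖(1 - adjoint B ∘L B) y‖ ≤ ‖y‖ := by
  have := norm_one_sub_adjoint_comp_self_apply_sq_le hB y
  exact le_of_sq_le_sq (by nlinarith [sq_nonneg ‖B y‖]) (norm_nonneg _)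

-- Put `A = B*B` and `T = 1 - A`. On the range of `A`, `‖T^k A z‖ = ‖A T^k z‖ ≤ ‖B T^k z‖`, and the
-- square of the last norm is at most the decrease of the convergent sequence `‖T^k z‖²`. Since `A`
-- is self-adjoint with the same kernel as `B`, `x` lies in the closure of the range of `A`, and the
-- contractions `T^k` carry the limit over to the closure.
open ContinuousLinearMap in
theorem tendsto_one_sub_adjoint_comp_self_pow_apply {B : H →L[ℝ] G} (hB : ‖B‖ ≤ 1) {x : H}
    (hx : ∀ y, B y = 0 → inner ℝ y x = 0) :
    Tendsto (fun k : ℕ => ((1 - adjoint B ∘L B) ^ k) x) atTop (𝓝 0) := by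
  set A : H →L[ℝ] H := adjoint B ∘L B with hA
  set T : H →L[ℝ] H := 1 - A with hT
  have hT1 : ∀ y, ‖T y‖ ≤ ‖y‖ := norm_one_sub_adjoint_comp_self_apply_le hB
  have hAB : ∀ y, ‖A y‖ ≤ ‖B y‖ := fun y => by
    refine (le_opNorm (adjoint B) (B y)).trans ?_
    rw [LinearIsometryEquiv.norm_map]
    exact mul_le_of_le_one_left (norm_nonneg _) hB
  have hcomm : ∀ k z, (T ^ k) (A z) = A ((T ^ k) z) := fun k z => by
    have : Commute (T ^ k) A := ((Commute.one_left A).sub_left (Commute.refl A)).pow_left k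
    exact congrArg (fun S : H →L[ℝ] H => S z) this.eq
  have hrange : ∀ z, Tendsto (fun k : ℕ => (T ^ k) (A z)) atTop (𝓝 0) := by
    intro z
    have hle : ∀ k, ‖B ((T ^ k) z)‖ ^ 2 ≤ ‖(T ^ k) z‖ ^ 2 - ‖(T ^ (k + 1)) z‖ ^ 2 := fun k => by
      have := norm_one_sub_adjoint_comp_self_apply_sq_le hB ((T ^ k) z)
      rw [pow_succ' T k]
      change _ ≤ _ - ‖T ((T ^ k) z)‖ ^ 2
      linarith
    have hanti : Antitone fun k : ℕ => ‖(T ^ k) z‖ ^ 2 := antitone_nat_of_succ_le fun k => by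
      nlinarith [hle k, sq_nonneg ‖B ((T ^ k) z)‖]
    obtain ⟨l, hl⟩ : ∃ l, Tendsto (fun k : ℕ => ‖(T ^ k) z‖ ^ 2) atTop (𝓝 l) :=
      ⟨_, tendsto_atTop_ciInf hanti ⟨0, by rintro _ ⟨k, rfl⟩; positivity⟩⟩
    have hdiff := hl.sub (hl.comp (tendsto_add_atTop_nat 1))
    rw [sub_self] at hdiff
    have hBsq : Tendsto (fun k : ℕ => ‖B ((T ^ k) z)‖ ^ 2) atTop (𝓝 0) :=
      squeeze_zero (fun k => by positivity) hle hdiff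
    have hBn : Tendsto (fun k : ℕ => ‖B ((T ^ k) z)‖) atTop (𝓝 0) := by
      have := hBsq.sqrt
      simpa using this
    refine squeeze_zero_norm (fun k => ?_) hBn
    rw [hcomm]
    exact hAB _
  have hself : adjoint A = A := by rw [hA, adjoint_comp, adjoint_adjoint]
  have hmem : x ∈ A.range.topologicalClosure := by
    have h := orthogonal_ker A
    rw [hself] at h
    rw [← h, Submodule.mem_orthogonal]
    intro y hy
    refine hx y ?_
    have h0 : A y = 0 := hy
    have : inner ℝ y (A y) = ‖B y‖ ^ 2 := by
      rw [hA, comp_apply, adjoint_inner_right, real_inner_self_eq_norm_sq]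
    rw [h0, inner_zero_right] at this
    simpa using this.symm
  rw [Metric.tendsto_atTop]
  intro ε hε
  obtain ⟨_, ⟨z, rfl⟩, hz⟩ := Metric.mem_closure_iff.1 hmem (ε / 2) (by positivity)
  obtain ⟨n, hn⟩ := Metric.tendsto_atTop.1 (hrange z) (ε / 2) (by positivity)
  refine ⟨n, fun k hk => ?_⟩
  have h1 := hn k hk
  rw [dist_zero_right] at h1 ⊢
  rw [dist_eq_norm] at hz
  calc ‖(T ^ k) x‖ = ‖(T ^ k) (x - A z) + (T ^ k) (A z)‖ := by rw [map_sub]; simp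
    _ ≤ ‖(T ^ k) (x - A z)‖ + ‖(T ^ k) (A z)‖ := norm_add_le _ _
    _ < ε / 2 + ε / 2 := add_lt_add ((norm_pow_apply_le hT1 k _).trans_lt hz) h1
    _ = ε := by ring

end HilbertSpace

theorem measurable_integral_prod_right {α β : Type*} [MeasurableSpace α] [MeasurableSpace β]
    {ν : Measure β} [SFinite ν] {g : α → β → ℝ} (hg : Measurable fun p : α × β => g p.1 p.2) :
    Measurable fun a => ∫ b, g a b ∂ν :=
  (hg.stronglyMeasurable.integral_prod_right' (ν := ν)).measurable

/-! ### Integral operators with bounded kernels -/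

section KernelOperator

variable {X Y : Type*} [MeasurableSpace X] [MeasurableSpace Y]

/-- A jointly measurable kernel with values in `[-1,1]`. -/
structure IsKernel (K : X → Y → ℝ) : Prop where
  measurable : Measurable fun p : X × Y => K p.1 p.2
  abs_le : ∀ x y, |K x y| ≤ 1

theorem IsKernel.swap {K : X → Y → ℝ} (hK : IsKernel K) : IsKernel fun y x => K x y :=
  ⟨hK.measurable.comp measurable_swap, fun y x => hK.abs_le x y⟩

theorem IsKernel.integrable_mul {μ : Measure X} {K : X → Y → ℝ} (hK : IsKernel K) (y : Y) {a : X → ℝ}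
    (ha : Integrable a μ) : Integrable (fun x => K x y * a x) μ :=
  ha.bdd_mul (c := 1) (hK.measurable.comp measurable_prodMk_right).aestronglyMeasurable
    (ae_of_all _ fun x => hK.abs_le x y)

theorem IsKernel.aestronglyMeasurable_integral {μ : Measure X} [SFinite μ] {ν : Measure Y}
    {K : X → Y → ℝ} (hK : IsKernel K) {a : X → ℝ} (ha : AEStronglyMeasurable a μ) :
    AEStronglyMeasurable (fun y => ∫ x, K x y * a x ∂μ) ν := by
  have : (fun y => ∫ x, K x y * a x ∂μ) = fun y => ∫ x, K x y * ha.mk a x ∂μ := by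
    ext y
    refine integral_congr_ae ?_
    filter_upwards [ha.ae_eq_mk] with x hx
    rw [hx]
  rw [this]
  refine (measurable_integral_prod_right ?_).aestronglyMeasurable
  exact (hK.measurable.comp measurable_swap).mul
    (ha.stronglyMeasurable_mk.measurable.comp measurable_snd)

theorem IsKernel.abs_integral_mul_le {K : X → Y → ℝ} (hK : IsKernel K) (y : Y) {μ : Measure X} {a : X → ℝ}
    (ha : Integrable a μ) : |∫ x, K x y * a x ∂μ| ≤ ∫ x, |a x| ∂μ := by
  refine (abs_integral_le_integral_abs).trans (integral_mono (hK.integrable_mul y ha).abs ha.abs ?_)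
  intro x
  change |K x y * a x| ≤ |a x|
  rw [abs_mul]
  exact mul_le_of_le_one_left (abs_nonneg _) (hK.abs_le x y)

variable {μ : Measure X} [IsProbabilityMeasure μ] {ν : Measure Y} [IsProbabilityMeasure ν]

theorem integral_abs_le_norm_Lp (a : Lp ℝ 2 μ) : ∫ x, |a x| ∂μ ≤ ‖a‖ := by
  have h1 : ∫ x, |a x| ∂μ = (eLpNorm a 1 μ).toReal := by
    rw [eLpNorm_one_eq_lintegral_enorm, ← integral_norm_eq_lintegral_enorm (Lp.aestronglyMeasurable a)]
    rfl
  rw [h1, Lp.norm_def]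
  exact ENNReal.toReal_mono (Lp.eLpNorm_ne_top a)
    (eLpNorm_le_eLpNorm_of_exponent_le (by norm_num) (Lp.aestronglyMeasurable a))

theorem integrable_Lp_two (a : Lp ℝ 2 μ) : Integrable a μ :=
  (Lp.memLp a).integrable (by norm_num)

theorem IsKernel.memLp_integral {K : X → Y → ℝ} (hK : IsKernel K) {a : X → ℝ}
    (ha : Integrable a μ) : MemLp (fun y => ∫ x, K x y * a x ∂μ) 2 ν :=
  MemLp.of_bound (hK.aestronglyMeasurable_integral ha.1) (∫ x, |a x| ∂μ)
    (ae_of_all _ fun y => hK.abs_integral_mul_le y ha)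

/-- The integral operator `L²(μ) → L²(ν)` with kernel `K`. -/
noncomputable def kernelOp (μ : Measure X) [IsProbabilityMeasure μ] (ν : Measure Y)
    [IsProbabilityMeasure ν] {K : X → Y → ℝ} (hK : IsKernel K) :
    Lp ℝ 2 μ →L[ℝ] Lp ℝ 2 ν :=
  LinearMap.mkContinuous
    { toFun := fun a => (hK.memLp_integral (ν := ν) (integrable_Lp_two a)).toLp _
      map_add' := fun a b => by
        rw [← MemLp.toLp_add]
        congr 1
        ext y
        rw [Pi.add_apply, ← integral_add (hK.integrable_mul y (integrable_Lp_two a))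
          (hK.integrable_mul y (integrable_Lp_two b))]
        refine integral_congr_ae ?_
        filter_upwards [Lp.coeFn_add a b] with x hx
        rw [hx, Pi.add_apply]
        ring
      map_smul' := fun c a => by
        rw [RingHom.id_apply, ← MemLp.toLp_const_smul]
        congr 1
        ext y
        rw [Pi.smul_apply, ← integral_smul]
        refine integral_congr_ae ?_
        filter_upwards [Lp.coeFn_smul c a] with x hx
        rw [hx, Pi.smul_apply, smul_eq_mul, smul_eq_mul]
        ring } 1
    (fun a => by
      rw [one_mul]
      refine (Lp.norm_le_of_ae_bound (norm_nonneg a) (C := ‖a‖) ?_).trans ?_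
      · filter_upwards [(hK.memLp_integral (ν := ν) (integrable_Lp_two a)).coeFn_toLp] with y hy
        change |(hK.memLp_integral (ν := ν) (integrable_Lp_two a)).toLp _ y| ≤ _
        rw [hy]
        exact (hK.abs_integral_mul_le y (integrable_Lp_two a)).trans (integral_abs_le_norm_Lp a)
      · simp [measureUnivNNReal])

theorem norm_kernelOp_le {K : X → Y → ℝ} (hK : IsKernel K) : ‖kernelOp μ ν hK‖ ≤ 1 :=
  LinearMap.mkContinuous_norm_le _ zero_le_one _

theorem kernelOp_apply_ae {K : X → Y → ℝ} (hK : IsKernel K) (a : Lp ℝ 2 μ) :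
    kernelOp μ ν hK a =ᵐ[ν] fun y => ∫ x, K x y * a x ∂μ :=
  (hK.memLp_integral (ν := ν) (integrable_Lp_two a)).coeFn_toLp

theorem adjoint_kernelOp {K : X → Y → ℝ} (hK : IsKernel K) :
    ContinuousLinearMap.adjoint (kernelOp μ ν hK) = kernelOp ν μ hK.swap := by
  symm
  rw [ContinuousLinearMap.eq_adjoint_iff]
  intro b a
  rw [L2.inner_def, L2.inner_def]
  simp only [RCLike.inner_apply, conj_trivial]
  have hint : Integrable (fun p : X × Y => K p.1 p.2 * (a p.1 * b p.2)) (μ.prod ν) :=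
    ((integrable_Lp_two a).mul_prod (integrable_Lp_two b)).bdd_mul (c := 1)
      hK.measurable.aestronglyMeasurable (ae_of_all _ fun p => hK.abs_le _ _)
  calc ∫ x, a x * kernelOp ν μ hK.swap b x ∂μ
      = ∫ x, ∫ y, K x y * (a x * b y) ∂ν ∂μ := by
        refine integral_congr_ae ?_
        filter_upwards [kernelOp_apply_ae (μ := ν) (ν := μ) hK.swap b] with x hx
        rw [hx, ← integral_const_mul]
        refine integral_congr_ae (ae_of_all _ fun y => ?_)
        change a x * (K x y * b y) = K x y * (a x * b y)
        ring
    _ = ∫ y, ∫ x, K x y * (a x * b y) ∂μ ∂ν := integral_integral_swap hint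
    _ = ∫ y, kernelOp μ ν hK a y * b y ∂ν := by
        refine integral_congr_ae ?_
        filter_upwards [kernelOp_apply_ae (μ := μ) (ν := ν) hK a] with y hy
        rw [hy, ← integral_mul_const]
        refine integral_congr_ae (ae_of_all _ fun x => ?_)
        change K x y * (a x * b y) = K x y * a x * b y
        ring

/-- The kernel `a - K Kᵀ a`, as a function. -/
noncomputable def residual (μ : Measure X) (ν : Measure Y) (K : X → Y → ℝ) (a : X → ℝ) (x : X) : ℝ :=
  a x - ∫ y, K x y * ∫ x', K x' y * a x' ∂μ ∂ν

theorem MemLp.residual {K : X → Y → ℝ} (hK : IsKernel K) {a : X → ℝ} (ha : MemLp a 2 μ) :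
    MemLp (residual μ ν K a) 2 μ := by
  refine ha.sub (hK.swap.memLp_integral ?_)
  exact (hK.memLp_integral (ha.integrable (by norm_num))).integrable (by norm_num)

/-- Carries the Hilbert space estimates over to `residual`, which acts on functions rather than
classes and so can be evaluated pointwise and is measurable jointly with the parameter `w`. -/
theorem toLp_residual {K : X → Y → ℝ} (hK : IsKernel K) {a : X → ℝ} (ha : MemLp a 2 μ) :
    (MemLp.residual (ν := ν) hK ha).toLp _
      = (1 - ContinuousLinearMap.adjoint (kernelOp μ ν hK) ∘L kernelOp μ ν hK) (ha.toLp a) := by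
  rw [adjoint_kernelOp]
  ext1
  refine (MemLp.coeFn_toLp _).trans ?_
  change _ =ᵐ[μ] (ha.toLp a - kernelOp ν μ hK.swap (kernelOp μ ν hK (ha.toLp a)) : Lp ℝ 2 μ)
  filter_upwards [Lp.coeFn_sub (ha.toLp a) (kernelOp ν μ hK.swap (kernelOp μ ν hK (ha.toLp a))),
    ha.coeFn_toLp, kernelOp_apply_ae (μ := ν) (ν := μ) hK.swap (kernelOp μ ν hK (ha.toLp a))]
    with x h1 h2 h3
  rw [h1, Pi.sub_apply, h2, h3, SKModel.residual]
  congr 1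
  refine integral_congr_ae ?_
  filter_upwards [kernelOp_apply_ae (μ := μ) (ν := ν) hK (ha.toLp a)] with y hy
  rw [hy]
  congr 1
  refine integral_congr_ae ?_
  filter_upwards [ha.coeFn_toLp] with x' hx'
  rw [hx']

theorem memLp_iterate_residual {K : X → Y → ℝ} (hK : IsKernel K) {a : X → ℝ} (ha : MemLp a 2 μ)
    (k : ℕ) : MemLp ((residual μ ν K)^[k] a) 2 μ := by
  induction k with
  | zero => exact ha
  | succ k ih => rw [Function.iterate_succ_apply']; exact MemLp.residual hK ih

theorem toLp_iterate_residual {K : X → Y → ℝ} (hK : IsKernel K) {a : X → ℝ} (ha : MemLp a 2 μ)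
    (k : ℕ) : (memLp_iterate_residual (ν := ν) hK ha k).toLp _
      = ((1 - ContinuousLinearMap.adjoint (kernelOp μ ν hK) ∘L kernelOp μ ν hK) ^ k)
          (ha.toLp a) := by
  induction k with
  | zero => rfl
  | succ k ih =>
    rw [pow_succ', mul_apply_eq_comp, ← ih,
      ← toLp_residual hK (memLp_iterate_residual hK ha k)]
    congr 1
    rw [Function.iterate_succ_apply']

theorem integral_abs_le_norm_toLp {a : X → ℝ} (ha : MemLp a 2 μ) :
    ∫ x, |a x| ∂μ ≤ ‖ha.toLp a‖ := by
  refine le_trans (le_of_eq (integral_congr_ae ?_)) (integral_abs_le_norm_Lp _)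
  filter_upwards [ha.coeFn_toLp] with x hx
  rw [hx]

theorem IsKernel.memLp_section {K : X → Y → ℝ} (hK : IsKernel K) (y : Y) :
    MemLp (fun x => K x y) 2 μ :=
  MemLp.of_bound (hK.measurable.comp measurable_prodMk_right).aestronglyMeasurable 1
    (ae_of_all _ fun x => hK.abs_le x y)

theorem integral_abs_iterate_residual_le {K : X → Y → ℝ} (hK : IsKernel K) (k : ℕ) (y : Y) :
    ∫ x, |(residual μ ν K)^[k] (fun x => K x y) x| ∂μ ≤ 1 := by
  refine (integral_abs_le_norm_toLp (memLp_iterate_residual hK (hK.memLp_section y) k)).trans ?_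
  rw [toLp_iterate_residual hK (hK.memLp_section y)]
  refine (norm_pow_apply_le (norm_one_sub_adjoint_comp_self_apply_le (norm_kernelOp_le hK)) _ _).trans
    ?_
  refine (Lp.norm_le_of_ae_bound zero_le_one (C := 1) ?_).trans (by simp [measureUnivNNReal])
  filter_upwards [(hK.memLp_section (μ := μ) y).coeFn_toLp] with x hx
  rw [hx]
  exact hK.abs_le x y

/-- Almost every section of `K` is orthogonal to the kernel of the integral operator. -/
theorem ae_section_orthogonal [SecondCountableTopology (Lp ℝ 2 μ)] {K : X → Y → ℝ}
    (hK : IsKernel K) :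
    ∀ᵐ y ∂ν, ∀ a : Lp ℝ 2 μ, kernelOp μ ν hK a = 0 →
      inner ℝ a ((hK.memLp_section (μ := μ) y).toLp _) = 0 := by
  -- The inner product of `a` with the section at `y` is `(K a)(y)`, which vanishes off a null set
  -- depending on `a`. A countable dense subset of the null space gives one null set for all `a`.
  let N : Submodule ℝ (Lp ℝ 2 μ) := (kernelOp μ ν hK).ker
  have hd := TopologicalSpace.denseRange_denseSeq N
  have h : ∀ᵐ y ∂ν, ∀ i, inner ℝ (TopologicalSpace.denseSeq N i : Lp ℝ 2 μ)
      ((hK.memLp_section (μ := μ) y).toLp _) = 0 := by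
    rw [ae_all_iff]
    intro i
    have h0 : kernelOp μ ν hK (TopologicalSpace.denseSeq N i : Lp ℝ 2 μ) = 0 :=
      (TopologicalSpace.denseSeq N i).2
    have h1 := kernelOp_apply_ae (ν := ν) hK (TopologicalSpace.denseSeq N i : Lp ℝ 2 μ)
    rw [h0] at h1
    filter_upwards [h1, Lp.coeFn_zero ℝ 2 ν] with y hy hy0
    rw [hy0, Pi.zero_apply] at hy
    rw [L2.inner_def, hy]
    refine integral_congr_ae ?_
    filter_upwards [(hK.memLp_section (μ := μ) y).coeFn_toLp] with x hx
    rw [hx]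
    simp
  filter_upwards [h] with y hy a ha
  have hcl : IsClosed {b : N | inner ℝ (b : Lp ℝ 2 μ) ((hK.memLp_section (μ := μ) y).toLp _) = 0} :=
    isClosed_eq (by fun_prop) continuous_const
  have := hd.induction_on (p := fun b : N => inner ℝ (b : Lp ℝ 2 μ)
    ((hK.memLp_section (μ := μ) y).toLp _) = 0) ⟨a, ha⟩ hcl hy
  exact this

theorem ae_tendsto_integral_abs_iterate_residual [SecondCountableTopology (Lp ℝ 2 μ)]
    {K : X → Y → ℝ} (hK : IsKernel K) :
    ∀ᵐ y ∂ν, Tendsto (fun k : ℕ => ∫ x, |(residual μ ν K)^[k] (fun x => K x y) x| ∂μ) atTop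
      (𝓝 0) := by
  filter_upwards [ae_section_orthogonal (μ := μ) (ν := ν) hK] with y hy
  have h := (tendsto_one_sub_adjoint_comp_self_pow_apply (norm_kernelOp_le hK) hy).norm
  rw [norm_zero] at h
  refine squeeze_zero (fun k => integral_nonneg fun x => abs_nonneg _) (fun k => ?_) h
  rw [← toLp_iterate_residual hK (hK.memLp_section y)]
  exact integral_abs_le_norm_toLp _

end KernelOperator

/-! ### Bounded measurable functions of `(w, u, v)` -/

instance (ι : Type) : IsProbabilityMeasure (uniformSeq ι) := by
  unfold uniformSeq; infer_instance

/-- A jointly measurable function of `(w, u, v)` with values in `[-1,1]`. -/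
structure IsField (s : I → I → I → ℝ) : Prop where
  measurable : Measurable fun p : I × I × I => s p.1 p.2.1 p.2.2
  abs_le : ∀ w u v, |s w u v| ≤ 1

theorem IsField.isKernel {s : I → I → I → ℝ} (hs : IsField s) (w : I) : IsKernel (s w) :=
  ⟨hs.measurable.comp measurable_prodMk_left, hs.abs_le w⟩

theorem IsField.measurable_comp {s : I → I → I → ℝ} (hs : IsField s) {α : Type*} [MeasurableSpace α]
    {f g h : α → I} (hf : Measurable f) (hg : Measurable g) (hh : Measurable h) :
    Measurable fun x => s (f x) (g x) (h x) :=
  hs.measurable.comp (hf.prodMk (hg.prodMk hh))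

theorem IsSpinFunction.abs_eq {σ : I → I → I → I → ℝ} (hσ : IsSpinFunction σ) (w u v x : I) :
    |σ w u v x| = 1 := by
  rcases hσ.eq_or_eq w u v x with h | h <;> simp [h]

theorem IsSpinFunction.isField_bar {σ : I → I → I → I → ℝ} (hσ : IsSpinFunction σ) :
    IsField (bar σ) where
  measurable := by
    refine measurable_integral_prod_right (α := I × I × I) (g := fun p x => σ p.1 p.2.1 p.2.2 x) ?_
    exact hσ.measurable.comp (f := fun p : (I × I × I) × I => (p.1.1, p.1.2.1, p.1.2.2, p.2))
      (by fun_prop)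
  abs_le w u v := by
    have := norm_integral_le_of_norm_le_const (μ := (volume : Measure I)) (f := σ w u v) (C := 1)
      (ae_of_all _ fun x => (hσ.abs_eq w u v x).le)
    simpa [bar] using this

section MultisetProd

variable {κ Ω : Type*} [MeasurableSpace Ω]

theorem measurable_multiset_map_prod (m : Multiset κ) {f : κ → Ω → ℝ} (hf : ∀ e, Measurable (f e)) :
    Measurable fun ω => (m.map fun e => f e ω).prod := by
  induction m using Multiset.induction with
  | empty => simp
  | cons a m ih => simp only [Multiset.map_cons, Multiset.prod_cons]; exact (hf a).mul ih

theorem abs_multiset_map_prod_le (m : Multiset κ) {f : κ → ℝ} (hf : ∀ e, |f e| ≤ 1) :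
    |(m.map f).prod| ≤ 1 := by
  induction m using Multiset.induction with
  | empty => simp
  | cons a m ih =>
    rw [Multiset.map_cons, Multiset.prod_cons, abs_mul]
    exact mul_le_one₀ (hf a) (abs_nonneg _) ih

end MultisetProd

/-! ### Homomorphism densities of bipartite multigraphs -/

/-- `∏_{e ∈ m} s(w, u_{e.1}, v_{e.2})`. -/
def edgeProd (s : I → I → I → ℝ) (m : Multiset (ℕ × ℕ)) (w : I) (u v : ℕ → I) : ℝ :=
  (m.map fun e => s w (u e.1) (v e.2)).prod

/-- The density of the bipartite multigraph `m` in `s`, with one more edge `e` carrying `h`. -/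
noncomputable def edgeDensity (s h : I → I → I → ℝ) (e : ℕ × ℕ) (m : Multiset (ℕ × ℕ)) : ℝ :=
  ∫ p : I × (ℕ → I) × (ℕ → I), h p.1 (p.2.1 e.1) (p.2.2 e.2) * edgeProd s m p.1 p.2.1 p.2.2
    ∂((volume : Measure I).prod ((uniformSeq ℕ).prod (uniformSeq ℕ)))

/-- The density of the bipartite multigraph `m` in `s`. -/
noncomputable def homDensity (s : I → I → I → ℝ) (m : Multiset (ℕ × ℕ)) : ℝ :=
  ∫ p : I × (ℕ → I) × (ℕ → I), edgeProd s m p.1 p.2.1 p.2.2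
    ∂((volume : Measure I).prod ((uniformSeq ℕ).prod (uniformSeq ℕ)))

theorem edgeProd_cons (s : I → I → I → ℝ) (e : ℕ × ℕ) (m : Multiset (ℕ × ℕ)) (w : I)
    (u v : ℕ → I) : edgeProd s (e ::ₘ m) w u v = s w (u e.1) (v e.2) * edgeProd s m w u v := by
  simp [edgeProd]

theorem edgeDensity_self (s : I → I → I → ℝ) (e : ℕ × ℕ) (m : Multiset (ℕ × ℕ)) :
    edgeDensity s s e m = homDensity s (e ::ₘ m) := by
  simp only [edgeDensity, homDensity, edgeProd_cons]

theorem measurable_edgeProd {s : I → I → I → ℝ} (hs : IsField s) (m : Multiset (ℕ × ℕ))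
    {α : Type*} [MeasurableSpace α] {f : α → I} {g h : α → ℕ → I} (hf : Measurable f)
    (hg : Measurable g) (hh : Measurable h) : Measurable fun x => edgeProd s m (f x) (g x) (h x) :=
  measurable_multiset_map_prod m fun _ => hs.measurable_comp hf
    ((measurable_pi_apply _).comp hg) ((measurable_pi_apply _).comp hh)

theorem abs_edgeProd_le {s : I → I → I → ℝ} (hs : IsField s) (m : Multiset (ℕ × ℕ)) (w : I)
    (u v : ℕ → I) : |edgeProd s m w u v| ≤ 1 :=
  abs_multiset_map_prod_le m fun _ => hs.abs_le w _ _

theorem edgeProd_update_left (s : I → I → I → ℝ) {m : Multiset (ℕ × ℕ)} {N : ℕ}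
    (hN : ∀ e ∈ m, e.1 ≠ N) (w : I) (u v : ℕ → I) (x : I) :
    edgeProd s m w (Function.update u N x) v = edgeProd s m w u v := by
  unfold edgeProd
  congr 1
  exact Multiset.map_congr rfl fun e he => by rw [Function.update_of_ne (hN e he)]

theorem edgeProd_update_right (s : I → I → I → ℝ) {m : Multiset (ℕ × ℕ)} {M : ℕ}
    (hM : ∀ e ∈ m, e.2 ≠ M) (w : I) (u v : ℕ → I) (y : I) :
    edgeProd s m w u (Function.update v M y) = edgeProd s m w u v := by
  unfold edgeProd
  congr 1
  exact Multiset.map_congr rfl fun e he => by rw [Function.update_of_ne (hM e he)]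

theorem integral_prod_update_right {α : Type*} [MeasurableSpace α] {ρ : Measure α}
    [IsProbabilityMeasure ρ] (M : ℕ) {Φ : α → (ℕ → I) → ℝ}
    (hΦ : Measurable fun p : α × (ℕ → I) => Φ p.1 p.2) {c : ℝ} (hb : ∀ x v, |Φ x v| ≤ c) :
    ∫ p, Φ p.1 p.2 ∂(ρ.prod (uniformSeq ℕ))
      = ∫ p, (∫ y : I, Φ p.1 (Function.update p.2 M y)) ∂(ρ.prod (uniformSeq ℕ)) := by
  have hup : Measurable fun p : (α × (ℕ → I)) × I => Φ p.1.1 (Function.update p.1.2 M p.2) :=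
    hΦ.comp ((measurable_fst.comp measurable_fst).prodMk
      ((measurable_update' (a := M)).comp
        ((measurable_snd.comp measurable_fst).prodMk measurable_snd)))
  rw [integral_prod _ (Integrable.of_bound hΦ.aestronglyMeasurable c (ae_of_all _ fun p => hb _ _)),
    integral_prod]
  · refine integral_congr_ae (ae_of_all _ fun x => ?_)
    exact integral_infinitePi_update volume M (hΦ.comp measurable_prodMk_left) (hb x)
  · refine Integrable.of_bound (C := c) (measurable_integral_prod_right hup).aestronglyMeasurable
      (ae_of_all _ fun p => ?_)
    simpa using norm_integral_le_of_norm_le_const (μ := (volume : Measure I))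
      (f := fun y => Φ p.1 (Function.update p.2 M y)) (ae_of_all _ fun y => hb _ _)

theorem integral_prod_update_left {α : Type*} [MeasurableSpace α] {ρ : Measure α}
    [IsProbabilityMeasure ρ] (N : ℕ) {Φ : (ℕ → I) → α → ℝ}
    (hΦ : Measurable fun p : (ℕ → I) × α => Φ p.1 p.2) {c : ℝ} (hb : ∀ u x, |Φ u x| ≤ c) :
    ∫ p, Φ p.1 p.2 ∂((uniformSeq ℕ).prod ρ)
      = ∫ p, (∫ y : I, Φ (Function.update p.1 N y) p.2) ∂((uniformSeq ℕ).prod ρ) := by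
  have h := integral_prod_update_right (ρ := ρ) N (Φ := fun x u => Φ u x)
    (hΦ.comp measurable_swap) fun x u => hb u x
  rw [← integral_prod_swap, ← integral_prod_swap (f := fun p : (ℕ → I) × α =>
    ∫ y : I, Φ (Function.update p.1 N y) p.2)]
  exact h

/-- `h ↦ s sᵀ h`, for every fixed `w`. -/
noncomputable def gram (s h : I → I → I → ℝ) (w u v : I) : ℝ := ∫ y, s w u y * ∫ x, s w x y * h w x v

theorem abs_integral_le_of_abs_le {α : Type*} [MeasurableSpace α] {ρ : Measure α}
    [IsProbabilityMeasure ρ] {f : α → ℝ} {c : ℝ} (h : ∀ x, |f x| ≤ c) : |∫ x, f x ∂ρ| ≤ c := by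
  simpa using norm_integral_le_of_norm_le_const (μ := ρ) (f := f) (ae_of_all _ h)

theorem measurable_gram {s h : I → I → I → ℝ} (hs : IsField s)
    (hh : Measurable fun p : I × I × I => h p.1 p.2.1 p.2.2) :
    Measurable fun p : I × I × I => gram s h p.1 p.2.1 p.2.2 := by
  have hinner : Measurable fun p : I × I × I => ∫ x, s p.1 x p.2.1 * h p.1 x p.2.2 := by
    refine measurable_integral_prod_right
      (g := fun (p : I × I × I) x => s p.1 x p.2.1 * h p.1 x p.2.2) ?_
    exact (hs.measurable_comp (by fun_prop) (by fun_prop) (by fun_prop)).mul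
      (hh.comp (f := fun p : (I × I × I) × I => (p.1.1, p.2, p.1.2.2)) (by fun_prop))
  refine measurable_integral_prod_right
    (g := fun (p : I × I × I) y => s p.1 p.2.1 y * ∫ x, s p.1 x y * h p.1 x p.2.2) ?_
  exact (hs.measurable_comp (by fun_prop) (by fun_prop) (by fun_prop)).mul
    (hinner.comp (f := fun p : (I × I × I) × I => (p.1.1, p.2, p.1.2.2)) (by fun_prop))

theorem abs_gram_le {s h : I → I → I → ℝ} (hs : IsField s) {c : ℝ} (hc : ∀ w u v, |h w u v| ≤ c)
    (w u v : I) : |gram s h w u v| ≤ c :=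
  abs_integral_le_of_abs_le fun y => by
    rw [abs_mul]
    refine (mul_le_of_le_one_left (abs_nonneg _) (hs.abs_le w u y)).trans ?_
    refine abs_integral_le_of_abs_le fun x => ?_
    rw [abs_mul]
    exact (mul_le_of_le_one_left (abs_nonneg _) (hs.abs_le w x y)).trans (hc w x v)

/-- The vertices `N` and `M` do not occur in `m`, so averaging over them affects only the three
factors on `(N,b)`, `(a,M)`, `(N,M)` and rebuilds the double integral of `gram`: `v_M` is its `y`
and `u_N` its `x`. -/
theorem edgeDensity_gram {s h : I → I → I → ℝ} (hs : IsField s)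
    (hh : Measurable fun p : I × I × I => h p.1 p.2.1 p.2.2) {c : ℝ} (hc : ∀ w u v, |h w u v| ≤ c)
    {a b N M : ℕ} {m : Multiset (ℕ × ℕ)} (hNa : a ≠ N) (hMb : b ≠ M) (hN : ∀ e ∈ m, e.1 ≠ N)
    (hM : ∀ e ∈ m, e.2 ≠ M) :
    edgeDensity s (gram s h) (a, b) m
      = edgeDensity s h (N, b) ((a, M) ::ₘ (N, M) ::ₘ m) := by
  have hh' : ∀ {α : Type} [MeasurableSpace α] {f g k : α → I}, Measurable f → Measurable g →
      Measurable k → Measurable fun x => h (f x) (g x) (k x) := fun hf hg hk =>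
    hh.comp (hf.prodMk (hg.prodMk hk))
  have hc0 : 0 ≤ c := (abs_nonneg _).trans (hc 0 0 0)
  have hsm : ∀ w u v, |s w u v| ≤ 1 := hs.abs_le
  have hPm : ∀ w u v, |edgeProd s m w u v| ≤ 1 := abs_edgeProd_le hs m
  have hgram := measurable_gram hs hh
  have hgram_le := abs_gram_le hs hc
  unfold edgeDensity
  rw [integral_prod, integral_prod]
  rotate_left
  · refine Integrable.of_bound (C := c) (Measurable.aestronglyMeasurable ?_)
      (ae_of_all _ fun p => ?_)
    · exact (hh' (by fun_prop) (by fun_prop) (by fun_prop)).mul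
        (measurable_edgeProd hs _ (by fun_prop) (by fun_prop) (by fun_prop))
    · rw [Real.norm_eq_abs, abs_mul]
      exact (mul_le_of_le_one_right (abs_nonneg _) (abs_edgeProd_le hs _ _ _ _)).trans (hc _ _ _)
  · refine Integrable.of_bound (C := c) (Measurable.aestronglyMeasurable ?_)
      (ae_of_all _ fun p => ?_)
    · exact (hgram.comp (f := fun p : I × (ℕ → I) × (ℕ → I) => (p.1, p.2.1 a, p.2.2 b))
        (by fun_prop)).mul (measurable_edgeProd hs _ (by fun_prop) (by fun_prop) (by fun_prop))
    · rw [Real.norm_eq_abs, abs_mul]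
      exact (mul_le_of_le_one_right (abs_nonneg _) (hPm _ _ _)).trans (hgram_le _ _ _)
  refine integral_congr_ae (ae_of_all _ fun w => ?_)
  symm
  dsimp only
  simp only [edgeProd_cons]
  -- Starting from the side with the path, resample `v_M` first and `u_N` afterwards.
  rw [integral_prod_update_right M (ρ := uniformSeq ℕ) (c := c)
    (Φ := fun u v => h w (u N) (v b) * (s w (u a) (v M) * (s w (u N) (v M) * edgeProd s m w u v)))]
  rotate_left
  · exact (hh' (by fun_prop) (by fun_prop) (by fun_prop)).mul
      ((hs.measurable_comp (by fun_prop) (by fun_prop) (by fun_prop)).mul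
        ((hs.measurable_comp (by fun_prop) (by fun_prop) (by fun_prop)).mul
          (measurable_edgeProd hs _ (by fun_prop) (by fun_prop) (by fun_prop))))
  · intro u v
    rw [abs_mul, abs_mul, abs_mul]
    exact (mul_le_of_le_one_right (abs_nonneg _) (mul_le_one₀ (hsm _ _ _) (by positivity)
      (mul_le_one₀ (hsm _ _ _) (abs_nonneg _) (hPm _ _ _)))).trans (hc _ _ _)
  simp only [Function.update_self, Function.update_of_ne hMb, edgeProd_update_right s hM]
  rw [integral_prod_update_left N (ρ := uniformSeq ℕ) (c := c)
    (Φ := fun u v => ∫ y, h w (u N) (v b) * (s w (u a) y * (s w (u N) y * edgeProd s m w u v)))]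
  rotate_left
  · refine measurable_integral_prod_right (α := (ℕ → I) × (ℕ → I)) (g := fun p y =>
      h w (p.1 N) (p.2 b) * (s w (p.1 a) y * (s w (p.1 N) y * edgeProd s m w p.1 p.2))) ?_
    exact (hh' (by fun_prop) (by fun_prop) (by fun_prop)).mul
      ((hs.measurable_comp (by fun_prop) (by fun_prop) (by fun_prop)).mul
        ((hs.measurable_comp (by fun_prop) (by fun_prop) (by fun_prop)).mul
          (measurable_edgeProd hs _ (by fun_prop) (by fun_prop) (by fun_prop))))
  · intro u v
    refine abs_integral_le_of_abs_le fun y => ?_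
    rw [abs_mul, abs_mul, abs_mul]
    exact (mul_le_of_le_one_right (abs_nonneg _) (mul_le_one₀ (hsm _ _ _) (by positivity)
      (mul_le_one₀ (hsm _ _ _) (abs_nonneg _) (hPm _ _ _)))).trans (hc _ _ _)
  simp only [Function.update_self, Function.update_of_ne hNa, edgeProd_update_left s hN]
  refine integral_congr_ae (ae_of_all _ fun p => ?_)
  dsimp only
  rw [integral_integral_swap]
  · rw [gram, ← integral_mul_const]
    refine integral_congr_ae (ae_of_all _ fun y => ?_)
    dsimp only
    rw [← integral_const_mul, ← integral_mul_const]
    refine integral_congr_ae (ae_of_all _ fun x => ?_)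
    dsimp only
    ring
  · refine Integrable.of_bound (C := c) (Measurable.aestronglyMeasurable ?_)
      (ae_of_all _ fun q => ?_)
    · exact (hh' (by fun_prop) (by fun_prop) (by fun_prop)).mul
        ((hs.measurable_comp (by fun_prop) (by fun_prop) (by fun_prop)).mul
          ((hs.measurable_comp (by fun_prop) (by fun_prop) (by fun_prop)).mul measurable_const))
    · rw [Real.norm_eq_abs]
      change |h w q.1 (p.2 b) * (s w (p.1 a) q.2 * (s w q.1 q.2 * edgeProd s m w p.1 p.2))| ≤ c
      rw [abs_mul, abs_mul, abs_mul]
      exact (mul_le_of_le_one_right (abs_nonneg _) (mul_le_one₀ (hsm _ _ _) (by positivity)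
        (mul_le_one₀ (hsm _ _ _) (abs_nonneg _) (hPm _ _ _)))).trans (hc _ _ _)

/-- `(1 - s sᵀ)^k s`, for every fixed `w`. -/
noncomputable def residField (s : I → I → I → ℝ) (k : ℕ) (w u v : I) : ℝ :=
  (residual volume volume (s w))^[k] (fun x => s w x v) u

theorem residField_zero (s : I → I → I → ℝ) : residField s 0 = s := rfl

theorem residField_succ (s : I → I → I → ℝ) (k : ℕ) (w u v : I) :
    residField s (k + 1) w u v = residField s k w u v - gram s (residField s k) w u v := by
  simp only [residField, Function.iterate_succ_apply']
  rfl

theorem measurable_residField {s : I → I → I → ℝ} (hs : IsField s) (k : ℕ) :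
    Measurable fun p : I × I × I => residField s k p.1 p.2.1 p.2.2 := by
  induction k with
  | zero => exact hs.measurable
  | succ k ih =>
    simp only [residField_succ]
    exact ih.sub (measurable_gram hs ih)

/-- A crude bound that only serves integrability; the bound uniform in `k` holds in `L¹` and comes
from the contraction. -/
theorem abs_residField_le {s : I → I → I → ℝ} (hs : IsField s) (k : ℕ) (w u v : I) :
    |residField s k w u v| ≤ 2 ^ k := by
  induction k generalizing w u v with
  | zero => simpa [residField_zero] using hs.abs_le w u v
  | succ k ih =>
    rw [residField_succ, pow_succ]
    refine (abs_sub _ _).trans ?_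
    linarith [ih w u v, abs_gram_le hs ih w u v]

theorem integrable_edge {s h : I → I → I → ℝ} (hs : IsField s)
    (hh : Measurable fun p : I × I × I => h p.1 p.2.1 p.2.2) {c : ℝ} (hc : ∀ w u v, |h w u v| ≤ c)
    (e : ℕ × ℕ) (m : Multiset (ℕ × ℕ)) :
    Integrable (fun p : I × (ℕ → I) × (ℕ → I) =>
      h p.1 (p.2.1 e.1) (p.2.2 e.2) * edgeProd s m p.1 p.2.1 p.2.2)
      ((volume : Measure I).prod ((uniformSeq ℕ).prod (uniformSeq ℕ))) := by
  refine Integrable.of_bound (C := c) (Measurable.aestronglyMeasurable ?_)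
    (ae_of_all _ fun p => ?_)
  · exact (hh.comp (f := fun p : I × (ℕ → I) × (ℕ → I) => (p.1, p.2.1 e.1, p.2.2 e.2))
      (by fun_prop)).mul (measurable_edgeProd hs _ (by fun_prop) (by fun_prop) (by fun_prop))
  · rw [Real.norm_eq_abs, abs_mul]
    exact (mul_le_of_le_one_right (abs_nonneg _) (abs_edgeProd_le hs _ _ _ _)).trans (hc _ _ _)

/-- In the correction term the edge from `a` to `b` has become the path `a – M – N – b`, whose last
edge now carries the residual. -/
theorem edgeDensity_residField_succ {s : I → I → I → ℝ} (hs : IsField s) (k : ℕ) {a b N M : ℕ}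
    {m : Multiset (ℕ × ℕ)} (hNa : a ≠ N) (hMb : b ≠ M) (hN : ∀ e ∈ m, e.1 ≠ N)
    (hM : ∀ e ∈ m, e.2 ≠ M) :
    edgeDensity s (residField s (k + 1)) (a, b) m
      = edgeDensity s (residField s k) (a, b) m
        - edgeDensity s (residField s k) (N, b) ((a, M) ::ₘ (N, M) ::ₘ m) := by
  have hr := measurable_residField hs k
  have hb := abs_residField_le hs k
  rw [← edgeDensity_gram hs hr hb hNa hMb hN hM]
  unfold edgeDensity
  rw [← integral_sub (integrable_edge hs hr hb _ _)
    (integrable_edge hs (measurable_gram hs hr) (abs_gram_le hs hb) _ _)]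
  simp only [residField_succ, sub_mul]

/-- For each `w` the `L¹` norms of almost all sections tend to zero, and they never exceed one;
dominated convergence applies in `v` and then in `w`. -/
theorem tendsto_integral_abs_residField {s : I → I → I → ℝ} (hs : IsField s) :
    Tendsto (fun k : ℕ => ∫ w, ∫ v, ∫ u, |residField s k w u v|) atTop (𝓝 0) := by
  have : Fact ((2 : ENNReal) ≠ ⊤) := ⟨by norm_num⟩
  have hm1 : ∀ k, Measurable fun p : I × I => ∫ u, |residField s k p.1 u p.2| := fun k => by
    refine measurable_integral_prod_right (g := fun (p : I × I) u => |residField s k p.1 u p.2|) ?_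
    exact ((measurable_residField hs k).comp (f := fun p : (I × I) × I => (p.1.1, p.2, p.1.2))
      (by fun_prop)).abs
  have hb1 : ∀ k w v, |(∫ u, |residField s k w u v| : ℝ)| ≤ 1 := fun k w v => by
    rw [abs_of_nonneg (integral_nonneg fun u => abs_nonneg _)]
    exact integral_abs_iterate_residual_le (hs.isKernel w) k v
  have h1 : ∀ w, Tendsto (fun k : ℕ => ∫ v, ∫ u, |residField s k w u v|) atTop (𝓝 0) := by
    intro w
    rw [← integral_zero I ℝ (μ := volume)]
    refine tendsto_integral_of_dominated_convergence (fun _ => 1)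
      (fun k => ((hm1 k).comp measurable_prodMk_left).aestronglyMeasurable)
      (integrable_const _) (fun k => ae_of_all _ fun v => hb1 k w v) ?_
    exact ae_tendsto_integral_abs_iterate_residual (hs.isKernel w)
  rw [← integral_zero I ℝ (μ := volume)]
  refine tendsto_integral_of_dominated_convergence (fun _ => 1)
    (fun k => (measurable_integral_prod_right (hm1 k)).aestronglyMeasurable)
    (integrable_const _) (fun k => ae_of_all _ fun w => abs_integral_le_of_abs_le (hb1 k w)) ?_
  exact ae_of_all _ h1

theorem measurePreserving_eval_pair (a b : ℕ) :
    MeasurePreserving (fun p : I × (ℕ → I) × (ℕ → I) => (p.1, p.2.1 a, p.2.2 b))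
      ((volume : Measure I).prod ((uniformSeq ℕ).prod (uniformSeq ℕ)))
      ((volume : Measure I).prod ((volume : Measure I).prod volume)) :=
  (MeasurePreserving.id volume).prod
    ((measurePreserving_eval_infinitePi (fun _ : ℕ => (volume : Measure I)) a).prod
      (measurePreserving_eval_infinitePi (fun _ : ℕ => (volume : Measure I)) b))

theorem tendsto_edgeDensity_residField {s : I → I → I → ℝ} (hs : IsField s) (e : ℕ × ℕ)
    (m : Multiset (ℕ × ℕ)) :
    Tendsto (fun k => edgeDensity s (residField s k) e m) atTop (𝓝 0) := by
  refine squeeze_zero_norm (fun k => ?_) (tendsto_integral_abs_residField hs)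
  have hr := measurable_residField hs k
  have hb := abs_residField_le hs k
  have hint : Integrable (fun p : I × I × I => |residField s k p.1 p.2.1 p.2.2|)
      ((volume : Measure I).prod ((volume : Measure I).prod volume)) :=
    Integrable.of_bound (C := 2 ^ k) hr.abs.aestronglyMeasurable
      (ae_of_all _ fun p => by simpa using hb _ _ _)
  have hmp := measurePreserving_eval_pair e.1 e.2
  calc ‖edgeDensity s (residField s k) e m‖
      ≤ ∫ p : I × (ℕ → I) × (ℕ → I), |residField s k p.1 (p.2.1 e.1) (p.2.2 e.2)|
          ∂((volume : Measure I).prod ((uniformSeq ℕ).prod (uniformSeq ℕ))) := by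
        refine norm_integral_le_of_norm_le (hmp.integrable_comp_of_integrable hint)
          (ae_of_all _ fun p => ?_)
        rw [Real.norm_eq_abs, abs_mul]
        exact mul_le_of_le_one_right (abs_nonneg _) (abs_edgeProd_le hs _ _ _ _)
    _ = ∫ p : I × I × I, |residField s k p.1 p.2.1 p.2.2|
          ∂((volume : Measure I).prod ((volume : Measure I).prod volume)) := by
        rw [← hmp.map_eq, integral_map hmp.measurable.aemeasurable hr.abs.aestronglyMeasurable]
    _ = ∫ w, ∫ v, ∫ u, |residField s k w u v| := by
        rw [integral_prod _ hint]
        refine integral_congr_ae (ae_of_all _ fun w => ?_)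
        dsimp only
        rw [integral_prod_symm]
        exact Integrable.of_bound (C := 2 ^ k)
          (hr.abs.comp measurable_prodMk_left).aestronglyMeasurable
          (ae_of_all _ fun p => by simpa using hb _ _ _)

theorem exists_fresh {κ : Type*} (m : Multiset κ) (f : κ → ℕ) (a : ℕ) :
    ∃ N, a ≠ N ∧ ∀ e ∈ m, f e ≠ N := by
  obtain ⟨N, hN⟩ := Infinite.exists_notMem_finset (a ::ₘ m.map f).toFinset
  simp only [Multiset.mem_toFinset, Multiset.mem_cons, Multiset.mem_map, not_or, not_exists,
    not_and] at hN
  exact ⟨N, fun h => hN.1 h.symm, hN.2⟩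

/-- The densities of simple graphs determine the densities of multigraphs. -/
theorem homDensity_eq_of_nodup {s t : I → I → I → ℝ} (hs : IsField s) (ht : IsField t)
    (h : ∀ m : Multiset (ℕ × ℕ), m.Nodup → homDensity s m = homDensity t m)
    (m : Multiset (ℕ × ℕ)) : homDensity s m = homDensity t m := by
  -- `S` is the simple part and `m'` holds the edges that may repeat. The induction on `m'` is for
  -- all `S` at once, because the new paths are added to `S`.
  suffices H : ∀ m' S : Multiset (ℕ × ℕ), S.Nodup →
      homDensity s (S + m') = homDensity t (S + m') by
    simpa using H m 0 Multiset.nodup_zero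
  intro m'
  induction m' using Multiset.induction with
  | empty => simpa using h
  | cons e m' ih =>
    have fresh : ∀ (a b : ℕ) (S : Multiset (ℕ × ℕ)), S.Nodup → ∃ N M : ℕ,
        a ≠ N ∧ b ≠ M ∧ (∀ e ∈ S + m', e.1 ≠ N) ∧ (∀ e ∈ S + m', e.2 ≠ M) ∧
        ((N, b) ::ₘ (a, M) ::ₘ (N, M) ::ₘ S).Nodup := by
      intro a b S hS
      obtain ⟨N, hNa, hN⟩ := exists_fresh (S + m') Prod.fst a
      obtain ⟨M, hMb, hM⟩ := exists_fresh (S + m') Prod.snd b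
      refine ⟨N, M, hNa, hMb, hN, hM, ?_⟩
      have hNS : ∀ y, (N, y) ∉ S := fun y hy => hN _ (Multiset.mem_add.2 (.inl hy)) rfl
      have hMS : ∀ x, (x, M) ∉ S := fun x hx => hM _ (Multiset.mem_add.2 (.inl hx)) rfl
      simp [Multiset.nodup_cons, hNS, hMS, hS, hNa, hNa.symm, hMb]
    -- When the marked edge is not in `S`, the recursion in `k` never leaves the graphs made of a
    -- simple part and `m'`, to which `ih` applies.
    have hk : ∀ (k a b : ℕ) (S : Multiset (ℕ × ℕ)), ((a, b) ::ₘ S).Nodup →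
        edgeDensity s (residField s k) (a, b) (S + m')
          = edgeDensity t (residField t k) (a, b) (S + m') := by
      intro k
      induction k with
      | zero =>
        intro a b S hS
        rw [residField_zero, residField_zero, edgeDensity_self, edgeDensity_self,
          ← Multiset.cons_add]
        exact ih _ hS
      | succ k ihk =>
        intro a b S hS
        obtain ⟨N, M, hNa, hMb, hN, hM, hnd⟩ := fresh a b S (Multiset.nodup_cons.1 hS).2
        rw [edgeDensity_residField_succ hs k hNa hMb hN hM,
          edgeDensity_residField_succ ht k hNa hMb hN hM, ihk a b S hS]
        have := ihk N b _ hnd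
        simp only [Multiset.cons_add] at this
        rw [this]
    intro S hS
    obtain ⟨a, b⟩ := e
    -- Here `(a, b)` may lie in `S`. Each correction term marks the new edge `(N, b)` and so agrees
    -- for `s` and `t` by `hk`; the difference is constant in `k`, while both densities tend to
    -- zero.
    have hconst : ∀ k, edgeDensity s (residField s k) (a, b) (S + m')
        - edgeDensity t (residField t k) (a, b) (S + m')
        = homDensity s (S + (a, b) ::ₘ m') - homDensity t (S + (a, b) ::ₘ m') := by
      intro k
      induction k with
      | zero =>
        rw [residField_zero, residField_zero, edgeDensity_self, edgeDensity_self,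
          Multiset.add_cons]
      | succ k ihk =>
        obtain ⟨N, M, hNa, hMb, hN, hM, hnd⟩ := fresh a b S hS
        rw [edgeDensity_residField_succ hs k hNa hMb hN hM,
          edgeDensity_residField_succ ht k hNa hMb hN hM, ← ihk]
        have := hk k N b _ hnd
        simp only [Multiset.cons_add] at this
        rw [this]
        ring
    have hlim := (tendsto_edgeDensity_residField hs (a, b) (S + m')).sub
      (tendsto_edgeDensity_residField ht (a, b) (S + m'))
    simp only [hconst, sub_zero] at hlim
    exact sub_eq_zero.1 (tendsto_nhds_unique tendsto_const_nhds hlim)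

/-! ### Moments of the spin array -/

theorem IsSpinFunction.measurable_comp {σ : I → I → I → I → ℝ} (hσ : IsSpinFunction σ) {α : Type*}
    [MeasurableSpace α] {f g h k : α → I} (hf : Measurable f) (hg : Measurable g)
    (hh : Measurable h) (hk : Measurable k) : Measurable fun x => σ (f x) (g x) (h x) (k x) :=
  hσ.measurable.comp (hf.prodMk (hg.prodMk (hh.prodMk hk)))

theorem measurable_arrayMap {σ : I → I → I → I → ℝ} (hσ : IsSpinFunction σ) :
    Measurable fun p : I × (ℕ → I) × (ℕ → I) × (ℕ × ℕ → I) =>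
      fun (i l : ℕ) => σ p.1 (p.2.1 l) (p.2.2.1 i) (p.2.2.2 (i, l)) :=
  measurable_pi_lambda _ fun i => measurable_pi_lambda _ fun l =>
    hσ.measurable_comp (by fun_prop) (by fun_prop) (by fun_prop) (by fun_prop)

theorem isProbabilityMeasure_arrayLaw {σ : I → I → I → I → ℝ} (hσ : IsSpinFunction σ) :
    IsProbabilityMeasure (arrayLaw σ) :=
  Measure.isProbabilityMeasure_map (measurable_arrayMap hσ).aemeasurable

theorem abs_prod_spin {σ : I → I → I → I → ℝ} (hσ : IsSpinFunction σ) (S : Finset (ℕ × ℕ))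
    (w : I) (u v : ℕ → I) (x : ℕ × ℕ → I) :
    |∏ e ∈ S, σ w (u e.1) (v e.2) (x (e.2, e.1))| ≤ 1 := by
  rw [Finset.abs_prod]
  exact Finset.prod_le_one (fun _ _ => abs_nonneg _) fun _ _ => (hσ.abs_eq _ _ _ _).le

/-- Distinct edges carry independent variables `x`, so each spin averages separately to `σ̄`; a
repeated edge would break this. Edges are (replica, site) but `x` is indexed by (site, replica),
hence the swap. -/
theorem integral_prod_spin {σ : I → I → I → I → ℝ} (hσ : IsSpinFunction σ) (S : Finset (ℕ × ℕ))
    (w : I) (u v : ℕ → I) :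
    ∫ x, ∏ e ∈ S, σ w (u e.1) (v e.2) (x (e.2, e.1)) ∂(uniformSeq (ℕ × ℕ))
      = edgeProd (bar σ) S.val w u v := by
  have h := integral_infinitePi_prod (volume : Measure I) (S.map (Equiv.prodComm ℕ ℕ).toEmbedding)
    (φ := fun q x => σ w (u q.2) (v q.1) x) fun q => hσ.measurable_comp (by fun_prop) (by fun_prop)
      (by fun_prop) (by fun_prop)
  simp only [Finset.prod_map] at h
  exact h

theorem integral_arrayLaw {σ : I → I → I → I → ℝ} (hσ : IsSpinFunction σ) (S : Finset (ℕ × ℕ)) :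
    ∫ x, ∏ e ∈ S, x e.2 e.1 ∂(arrayLaw σ) = homDensity (bar σ) S.val := by
  have hmeas : Measurable fun p : I × (ℕ → I) × (ℕ → I) × (ℕ × ℕ → I) =>
      ∏ e ∈ S, σ p.1 (p.2.1 e.1) (p.2.2.1 e.2) (p.2.2.2 (e.2, e.1)) :=
    Finset.measurable_prod _ fun e _ =>
      hσ.measurable_comp (by fun_prop) (by fun_prop) (by fun_prop) (by fun_prop)
  have hint : ∀ {α : Type} [MeasurableSpace α] (ρ : Measure α) [IsProbabilityMeasure ρ]
      (f : α → I × (ℕ → I) × (ℕ → I) × (ℕ × ℕ → I)), Measurable f →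
      Integrable (fun a => ∏ e ∈ S, σ (f a).1 ((f a).2.1 e.1) ((f a).2.2.1 e.2)
        ((f a).2.2.2 (e.2, e.1))) ρ := fun ρ _ f hf =>
    Integrable.of_bound (C := 1) (hmeas.comp hf).aestronglyMeasurable
      (ae_of_all _ fun a => abs_prod_spin hσ S _ _ _ _)
  have hint' : ∀ {α : Type} [MeasurableSpace α] (ρ : Measure α) [IsProbabilityMeasure ρ]
      (f : α → I × (ℕ → I) × (ℕ → I)), Measurable f →
      Integrable (fun a => edgeProd (bar σ) S.val (f a).1 (f a).2.1 (f a).2.2) ρ := fun ρ _ f hf =>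
    Integrable.of_bound (C := 1) (measurable_edgeProd hσ.isField_bar _ (by fun_prop) (by fun_prop)
      (by fun_prop)).aestronglyMeasurable
      (ae_of_all _ fun a => abs_edgeProd_le hσ.isField_bar _ _ _ _)
  rw [arrayLaw, integral_map (measurable_arrayMap hσ).aemeasurable (Measurable.aestronglyMeasurable
    (by fun_prop)), homDensity, integral_prod, integral_prod]
  rotate_left
  · exact hint' _ _ measurable_id
  · exact hint _ _ measurable_id
  refine integral_congr_ae (ae_of_all _ fun w => ?_)
  dsimp only
  rw [integral_prod, integral_prod]
  rotate_left
  · exact hint' _ _ measurable_prodMk_left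
  · exact hint _ _ measurable_prodMk_left
  refine integral_congr_ae (ae_of_all _ fun u => ?_)
  dsimp only
  rw [integral_prod]
  rotate_left
  · exact hint _ (fun q => (w, u, q)) (by fun_prop)
  refine integral_congr_ae (ae_of_all _ fun v => ?_)
  exact integral_prod_spin hσ S w u v

/-- Equal factors cancel in pairs: `S` consists of the elements that occur an odd number of times.
-/
theorem exists_finset_prod_eq_of_sq_eq_one {κ : Type*} (L : List κ) :
    ∃ S : Finset κ, ∀ x : κ → ℝ, (∀ e, x e * x e = 1) → (L.map x).prod = ∏ e ∈ S, x e := by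
  classical
  induction L with
  | nil => exact ⟨∅, by simp⟩
  | cons a L ih =>
    obtain ⟨S, hS⟩ := ih
    by_cases ha : a ∈ S
    · refine ⟨S.erase a, fun x hx => ?_⟩
      rw [List.map_cons, List.prod_cons, hS x hx, ← Finset.mul_prod_erase S x ha, ← mul_assoc, hx a,
        one_mul]
    · refine ⟨insert a S, fun x hx => ?_⟩
      rw [List.map_cons, List.prod_cons, hS x hx, Finset.prod_insert ha]

theorem ae_arrayLaw_sq {σ : I → I → I → I → ℝ} (hσ : IsSpinFunction σ) :
    ∀ᵐ x ∂(arrayLaw σ), ∀ i l, x i l * x i l = 1 := by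
  simp only [ae_all_iff]
  intro i l
  rw [arrayLaw, ae_map_iff (measurable_arrayMap hσ).aemeasurable
    (measurableSet_eq_fun (by fun_prop) (by fun_prop))]
  refine ae_of_all _ fun p => ?_
  rcases hσ.eq_or_eq p.1 (p.2.1 l) (p.2.2.1 i) (p.2.2.2 (i, l)) with h | h <;> simp [h]

theorem arrayLaw_eq_of_homDensity {σ τ : I → I → I → I → ℝ} (hσ : IsSpinFunction σ)
    (hτ : IsSpinFunction τ)
    (h : ∀ S : Finset (ℕ × ℕ), homDensity (bar σ) S.val = homDensity (bar τ) S.val) :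
    arrayLaw σ = arrayLaw τ := by
  let c : (ℕ → ℕ → ℝ) → ℕ × ℕ → ℝ := fun x e => x e.2 e.1
  let d : (ℕ × ℕ → ℝ) → ℕ → ℕ → ℝ := fun x i l => x (l, i)
  have hc : Measurable c := by fun_prop
  have hd : Measurable d := by fun_prop
  have hdc : ∀ ρ : Measure (ℕ → ℕ → ℝ), (ρ.map c).map d = ρ := fun ρ => by
    rw [Measure.map_map hd hc]; exact Measure.map_id
  have hpσ := isProbabilityMeasure_arrayLaw hσ
  have hpτ := isProbabilityMeasure_arrayLaw hτ
  rw [← hdc (arrayLaw σ), ← hdc (arrayLaw τ)]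
  congr 1
  have hae : ∀ {ρ : I → I → I → I → ℝ}, IsSpinFunction ρ →
      ∀ᵐ x ∂((arrayLaw ρ).map c), ∀ e, |x e| ≤ 1 := by
    intro ρ hρ
    rw [ae_all_iff]
    intro e
    rw [ae_map_iff hc.aemeasurable (measurableSet_le (by fun_prop) (by fun_prop))]
    filter_upwards [ae_arrayLaw_sq hρ] with x hx
    have := hx e.2 e.1
    exact abs_le_one_iff_mul_self_le_one.2 this.le
  refine measure_ext_of_moments (hae hσ) (hae hτ) fun L => ?_
  obtain ⟨S, hS⟩ := exists_finset_prod_eq_of_sq_eq_one L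
  have key : ∀ {ρ : I → I → I → I → ℝ}, IsSpinFunction ρ →
      ∫ x, (L.map x).prod ∂((arrayLaw ρ).map c) = homDensity (bar ρ) S.val := by
    intro ρ hρ
    rw [integral_map hc.aemeasurable, ← integral_arrayLaw hρ]
    · refine integral_congr_ae ?_
      filter_upwards [ae_arrayLaw_sq hρ] with x hx
      exact hS (c x) fun e => hx e.2 e.1
    · refine Measurable.aestronglyMeasurable ?_
      exact measurable_multiset_map_prod (L : Multiset (ℕ × ℕ))
        (f := fun e (x : ℕ × ℕ → ℝ) => x e)
        fun e => measurable_pi_apply e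
  rw [key hσ, key hτ, h S]

theorem homDensity_eq_of_arrayLaw_eq {σ τ : I → I → I → I → ℝ} (hσ : IsSpinFunction σ)
    (hτ : IsSpinFunction τ) (h : arrayLaw σ = arrayLaw τ) (m : Multiset (ℕ × ℕ)) :
    homDensity (bar σ) m = homDensity (bar τ) m := by
  refine homDensity_eq_of_nodup hσ.isField_bar hτ.isField_bar (fun m hm => ?_) m
  have h1 := integral_arrayLaw hσ ⟨m, hm⟩
  have h2 := integral_arrayLaw hτ ⟨m, hm⟩
  rw [h] at h1
  exact h1.symm.trans h2

/-! ### Multi-overlaps as multigraph densities -/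

theorem measurable_multiOverlap {s : I → I → I → ℝ} (hs : IsField s)
    (a : Σ k : ℕ, (Fin (k + 1) → ℕ)) :
    Measurable fun p : I × (ℕ → I) => ∫ v : I, ∏ j : Fin (a.1 + 1), s p.1 (p.2 (a.2 j)) v := by
  refine measurable_integral_prod_right (α := I × (ℕ → I))
    (g := fun p v => ∏ j : Fin (a.1 + 1), s p.1 (p.2 (a.2 j)) v) ?_
  exact Finset.measurable_prod _ fun j _ =>
    hs.measurable_comp (by fun_prop) (by fun_prop) (by fun_prop)

theorem abs_prod_field_le {s : I → I → I → ℝ} (hs : IsField s) {κ : Type*} (S : Finset κ)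
    (w u v : κ → I) : |∏ j ∈ S, s (w j) (u j) (v j)| ≤ 1 := by
  rw [Finset.abs_prod]
  exact Finset.prod_le_one (fun _ _ => abs_nonneg _) fun _ _ => hs.abs_le _ _ _

/-- The multigraph whose `p`-th right vertex is joined to the left vertices in the `p`-th tuple. -/
def tupleEdges (L : List (Σ k : ℕ, (Fin (k + 1) → ℕ))) : Multiset (ℕ × ℕ) :=
  (Finset.univ : Finset (Σ p : Fin L.length, Fin ((L.get p).1 + 1))).val.map
    fun q => ((L.get q.1).2 q.2, (q.1 : ℕ))

theorem edgeProd_tupleEdges (s : I → I → I → ℝ) (L : List (Σ k : ℕ, (Fin (k + 1) → ℕ))) (w : I)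
    (u v : ℕ → I) : edgeProd s (tupleEdges L) w u v
      = ∏ p : Fin L.length, ∏ j : Fin ((L.get p).1 + 1), s w (u ((L.get p).2 j)) (v p) := by
  rw [edgeProd, tupleEdges, Multiset.map_map]
  exact Fintype.prod_sigma _

theorem integral_infinitePi_prod_fin {X : Type*} [MeasurableSpace X] (μ : Measure X)
    [IsProbabilityMeasure μ] (n : ℕ) {φ : Fin n → X → ℝ} (hφ : ∀ i, Measurable (φ i)) :
    ∫ x : ℕ → X, ∏ i : Fin n, φ i (x i) ∂(Measure.infinitePi fun _ => μ)
      = ∏ i : Fin n, ∫ y, φ i y ∂μ := by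
  have h := integral_infinitePi_prod μ (Finset.range n)
    (φ := fun i x => if hi : i < n then φ ⟨i, hi⟩ x else 1) fun i => by
      by_cases hi : i < n
      · simpa [hi] using hφ _
      · simp [hi]
  simpa [Finset.prod_range] using h

theorem integral_edgeProd_tupleEdges {s : I → I → I → ℝ} (hs : IsField s)
    (L : List (Σ k : ℕ, (Fin (k + 1) → ℕ))) (w : I) (u : ℕ → I) :
    ∫ v, edgeProd s (tupleEdges L) w u v ∂(uniformSeq ℕ)
      = (L.map fun a => ∫ v : I, ∏ j : Fin (a.1 + 1), s w (u (a.2 j)) v).prod := by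
  simp only [edgeProd_tupleEdges]
  have h := integral_infinitePi_prod_fin (volume : Measure I) L.length
    (φ := fun p v => ∏ j : Fin ((L.get p).1 + 1), s w (u ((L.get p).2 j)) v) fun p =>
      Finset.measurable_prod _ fun j _ =>
        hs.measurable_comp (by fun_prop) (by fun_prop) (by fun_prop)
  refine h.trans ?_
  rw [← List.prod_ofFn]
  congr 1
  conv_rhs => rw [← List.ofFn_get L, List.map_ofFn]
  rfl

/-- Each tuple of `L` has its own right vertex, so the average over `v` factorizes into
multi-overlaps. A replica repeated within a tuple produces a multiple edge. -/
theorem integral_multiOverlapLaw {s : I → I → I → ℝ} (hs : IsField s)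
    (L : List (Σ k : ℕ, (Fin (k + 1) → ℕ))) :
    ∫ x, (L.map x).prod ∂(multiOverlapLaw s) = homDensity s (tupleEdges L) := by
  have hm : Measurable fun (p : I × (ℕ → I)) (a : Σ k : ℕ, (Fin (k + 1) → ℕ)) =>
      ∫ v : I, ∏ j : Fin (a.1 + 1), s p.1 (p.2 (a.2 j)) v :=
    measurable_pi_lambda _ (measurable_multiOverlap hs)
  have hL : Measurable fun x : (Σ k : ℕ, (Fin (k + 1) → ℕ)) → ℝ => (L.map x).prod :=
    measurable_multiset_map_prod (L : Multiset (Σ k : ℕ, (Fin (k + 1) → ℕ)))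
      (f := fun e (x : (Σ k : ℕ, (Fin (k + 1) → ℕ)) → ℝ) => x e) fun e => measurable_pi_apply e
  have hb : ∀ (w : I) (u : ℕ → I),
      |(L.map fun a => ∫ v : I, ∏ j : Fin (a.1 + 1), s w (u (a.2 j)) v).prod| ≤ 1 :=
    fun w u => abs_multiset_map_prod_le (L : Multiset (Σ k : ℕ, (Fin (k + 1) → ℕ)))
      (f := fun a => ∫ v : I, ∏ j : Fin (a.1 + 1), s w (u (a.2 j)) v) fun a => abs_integral_le_of_abs_le fun v => abs_prod_field_le hs _ _ _ _
  rw [multiOverlapLaw, integral_map hm.aemeasurable hL.aestronglyMeasurable, homDensity,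
    integral_prod, integral_prod]
  rotate_left
  · exact Integrable.of_bound (C := 1) (measurable_edgeProd hs _ (by fun_prop) (by fun_prop)
      (by fun_prop)).aestronglyMeasurable (ae_of_all _ fun a => abs_edgeProd_le hs _ _ _ _)
  · exact Integrable.of_bound (C := 1) (hL.comp hm).aestronglyMeasurable
      (ae_of_all _ fun p => hb _ _)
  refine integral_congr_ae (ae_of_all _ fun w => ?_)
  dsimp only
  rw [integral_prod]
  rotate_left
  · exact Integrable.of_bound (C := 1) (measurable_edgeProd hs _ (by fun_prop) (by fun_prop)
      (by fun_prop)).aestronglyMeasurable (ae_of_all _ fun a => abs_edgeProd_le hs _ _ _ _)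
  refine integral_congr_ae (ae_of_all _ fun u => ?_)
  exact (integral_edgeProd_tupleEdges hs L w u).symm

theorem multiOverlapLaw_eq_of_homDensity {s t : I → I → I → ℝ} (hs : IsField s) (ht : IsField t)
    (h : ∀ m, homDensity s m = homDensity t m) : multiOverlapLaw s = multiOverlapLaw t := by
  have hm : ∀ {r : I → I → I → ℝ}, IsField r →
      Measurable fun (p : I × (ℕ → I)) (a : Σ k : ℕ, (Fin (k + 1) → ℕ)) =>
        ∫ v : I, ∏ j : Fin (a.1 + 1), r p.1 (p.2 (a.2 j)) v := fun hr =>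
    measurable_pi_lambda _ (measurable_multiOverlap hr)
  have hp : ∀ {r : I → I → I → ℝ}, IsField r → IsProbabilityMeasure (multiOverlapLaw r) :=
    fun hr => Measure.isProbabilityMeasure_map (hm hr).aemeasurable
  have hae : ∀ {r : I → I → I → ℝ}, IsField r →
      ∀ᵐ x ∂(multiOverlapLaw r), ∀ a, |x a| ≤ 1 := by
    intro r hr
    rw [ae_all_iff]
    intro a
    rw [multiOverlapLaw, ae_map_iff (hm hr).aemeasurable
      (measurableSet_le (by fun_prop) (by fun_prop))]
    exact ae_of_all _ fun p => abs_integral_le_of_abs_le fun v => abs_prod_field_le hr _ _ _ _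
  have := hp hs
  have := hp ht
  refine measure_ext_of_moments (hae hs) (hae ht) fun L => ?_
  rw [integral_multiOverlapLaw hs, integral_multiOverlapLaw ht, h]

theorem overlapLaw_eq_map_multiOverlapLaw {s : I → I → I → ℝ} (hs : IsField s) :
    overlapLaw s = (multiOverlapLaw s).map fun x a => x ⟨1, ![a.1, a.2]⟩ := by
  rw [multiOverlapLaw, Measure.map_map (by fun_prop)
    (measurable_pi_lambda _ (measurable_multiOverlap hs)), overlapLaw]
  congr 1
  funext p a
  simp [overlap, Fin.prod_univ_two]

/-! ### Overlaps and covariance functions -/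

theorem measurable_overlap {s : I → I → I → ℝ} (hs : IsField s) {α : Type*} [MeasurableSpace α]
    {f g h : α → I} (hf : Measurable f) (hg : Measurable g) (hh : Measurable h) :
    Measurable fun x => overlap s (f x) (g x) (h x) := by
  refine measurable_integral_prod_right (g := fun x v => s (f x) (g x) v * s (f x) (h x) v) ?_
  exact (hs.measurable_comp (by fun_prop) (by fun_prop) (by fun_prop)).mul
    (hs.measurable_comp (by fun_prop) (by fun_prop) (by fun_prop))

theorem overlap_mem_Icc {s : I → I → I → ℝ} (hs : IsField s) (w u u' : I) :
    overlap s w u u' ∈ Set.Icc (-1 : ℝ) 1 :=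
  abs_le.1 (abs_integral_le_of_abs_le fun v => by
    rw [abs_mul]
    exact mul_le_one₀ (hs.abs_le w u v) (abs_nonneg _) (hs.abs_le w u' v))

/-- `ξ'` for the fields `g i`, and `θ` for the fields `h k`. -/
noncomputable def covFun (β : ℕ → ℝ) : ℕ ⊕ ℕ → ℝ → ℝ :=
  Sum.elim (fun _ => xiDeriv β) (fun _ => theta β)

/-- The continuous extension of the covariance functions from `[-1,1]` to the real line. -/
noncomputable def covExt (β : ℕ → ℝ) (j : ℕ ⊕ ℕ) (x : ℝ) : ℝ :=
  covFun β j (Set.projIcc (-1 : ℝ) 1 (by norm_num) x)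

theorem covExt_of_mem {β : ℕ → ℝ} (j : ℕ ⊕ ℕ) {x : ℝ} (hx : x ∈ Set.Icc (-1 : ℝ) 1) :
    covExt β j x = covFun β j x := by
  rw [covExt, Set.projIcc_of_mem _ hx]

theorem IsMixture.summable_succ {β : ℕ → ℝ} (hβ : IsMixture β) :
    Summable fun p : ℕ => ((p : ℝ) + 1) * β (p + 1) ^ 2 := by
  have := (summable_nat_add_iff 1).2 hβ.summable
  simpa using this

theorem abs_mul_pow_le {c x : ℝ} (hc : 0 ≤ c) (hx : x ∈ Set.Icc (-1 : ℝ) 1) (n : ℕ) :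
    ‖c * x ^ n‖ ≤ c := by
  rw [Real.norm_eq_abs, abs_mul, abs_of_nonneg hc, abs_pow]
  exact mul_le_of_le_one_right hc (pow_le_one₀ (abs_nonneg _) (abs_le.2 hx))

/-- With the argument clamped to `[-1,1]`, the terms `p β_p²` are a summable majorant for both
series; outside that interval the original series may diverge. -/
theorem continuous_covExt {β : ℕ → ℝ} (hβ : IsMixture β) (j : ℕ ⊕ ℕ) :
    Continuous (covExt β j) := by
  have hp : Continuous fun x : ℝ => ((Set.projIcc (-1 : ℝ) 1 (by norm_num) x : Set.Icc (-1 : ℝ) 1) : ℝ) :=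
    continuous_subtype_val.comp continuous_projIcc
  have h1 : Continuous fun x : ℝ =>
      xiDeriv β (Set.projIcc (-1 : ℝ) 1 (by norm_num) x : Set.Icc (-1 : ℝ) 1) :=
    continuous_tsum (fun p => by fun_prop) hβ.summable_succ
      fun p x => abs_mul_pow_le (by positivity) (Subtype.prop _) p
  have h2 : Continuous fun x : ℝ =>
      xi β (Set.projIcc (-1 : ℝ) 1 (by norm_num) x : Set.Icc (-1 : ℝ) 1) := by
    refine continuous_tsum (fun p => by fun_prop) hβ.summable_succ fun p x => ?_
    refine (abs_mul_pow_le (by positivity) (Subtype.prop _) _).trans ?_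
    exact le_mul_of_one_le_left (by positivity) (by linarith [p.cast_nonneg (α := ℝ)])
  cases j with
  | inl _ => exact h1
  | inr _ => exact (hp.mul h1).sub h2

theorem exists_abs_covFun_le {β : ℕ → ℝ} (hβ : IsMixture β) :
    ∃ B : ℝ, 0 ≤ B ∧ ∀ j, ∀ x ∈ Set.Icc (-1 : ℝ) 1, |covFun β j x| ≤ B := by
  have h : ∀ j, ∃ B : ℝ, ∀ x ∈ Set.Icc (-1 : ℝ) 1, |covFun β j x| ≤ B := fun j => by
    obtain ⟨B, hB⟩ := isCompact_Icc.exists_bound_of_continuousOn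
      (continuous_covExt hβ j).continuousOn (s := Set.Icc (-1 : ℝ) 1)
    exact ⟨B, fun x hx => by simpa [covExt_of_mem j hx] using hB x hx⟩
  obtain ⟨B₁, h₁⟩ := h (.inl 0)
  obtain ⟨B₂, h₂⟩ := h (.inr 0)
  refine ⟨max 0 (max B₁ B₂), le_max_left _ _, fun j x hx => ?_⟩
  cases j with
  | inl i => exact (h₁ x hx).trans ((le_max_left _ _).trans (le_max_right _ _))
  | inr i => exact (h₂ x hx).trans ((le_max_right _ _).trans (le_max_right _ _))

/-! ### The fields -/

section Fields

variable {Ω : Type}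

/-- `G_{ξ',i}` for the index `inl i` and `G_{θ,k}` for the index `inr k`. -/
noncomputable def fieldValue (β : ℕ → ℝ) (s : I → I → I → ℝ) (g h : ℕ → I → I → Ω → ℝ) (w u : I) (ω : Ω)
    (ζ : (ℕ → ℝ) × (ℕ → ℝ)) : ℕ ⊕ ℕ → ℝ :=
  Sum.elim (fun i => fieldXi β s w u (g i w u ω) (ζ.1 i))
    (fun k => fieldTheta β s w u (h k w u ω) (ζ.2 k))

theorem fieldValue_eq {β : ℕ → ℝ} {s : I → I → I → ℝ} (hs : IsField s)
    (g h : ℕ → I → I → Ω → ℝ) (w u : I) (ω : Ω) (ζ : (ℕ → ℝ) × (ℕ → ℝ)) (j : ℕ ⊕ ℕ) :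
    fieldValue β s g h w u ω ζ j = Sum.elim g h j w u ω
      + Sum.elim ζ.1 ζ.2 j * Real.sqrt (covExt β j 1 - covExt β j (overlap s w u u)) := by
  rw [covExt_of_mem j (overlap_mem_Icc hs w u u), covExt_of_mem j (by norm_num)]
  cases j <;> rfl

variable [MeasurableSpace Ω] {P : Measure Ω} {β : ℕ → ℝ} {s : I → I → I → ℝ} {g h : ℕ → I → I → Ω → ℝ}

theorem IsFieldFamily.measurable_elim (hF : IsFieldFamily P β s g h) (j : ℕ ⊕ ℕ) :
    Measurable fun p : I × I × Ω => Sum.elim g h j p.1 p.2.1 p.2.2 := by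
  cases j with
  | inl i => exact hF.measurable_g i
  | inr k => exact hF.measurable_h k

theorem IsFieldFamily.gaussian_elim (hF : IsFieldFamily P β s g h) (j : ℕ ⊕ ℕ) (w : I) :
    IsGaussianProcess (fun u : I => Sum.elim g h j w u) P := by
  cases j with
  | inl i => exact hF.gaussian_g i w
  | inr k => exact hF.gaussian_h k w

theorem IsFieldFamily.mean_elim (hF : IsFieldFamily P β s g h) (j : ℕ ⊕ ℕ) (w u : I) :
    ∫ ω, Sum.elim g h j w u ω ∂P = 0 := by
  cases j with
  | inl i => exact hF.mean_g i w u
  | inr k => exact hF.mean_h k w u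

theorem IsFieldFamily.cov_elim (hF : IsFieldFamily P β s g h) (hs : IsField s) (j : ℕ ⊕ ℕ)
    (w u u' : I) :
    cov[Sum.elim g h j w u, Sum.elim g h j w u'; P] = covExt β j (overlap s w u u') := by
  rw [covExt_of_mem j (overlap_mem_Icc hs w u u')]
  cases j with
  | inl i => exact hF.cov_g i w u u'
  | inr k => exact hF.cov_h k w u u'

theorem measurable_sum_elim_apply (j : ℕ ⊕ ℕ) :
    Measurable fun ζ : (ℕ → ℝ) × (ℕ → ℝ) => Sum.elim ζ.1 ζ.2 j := by
  cases j with
  | inl i => exact (measurable_pi_apply i).comp measurable_fst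
  | inr k => exact (measurable_pi_apply k).comp measurable_snd

theorem IsFieldFamily.measurable_fieldValue (hF : IsFieldFamily P β s g h) (hβ : IsMixture β)
    (hs : IsField s) (j : ℕ ⊕ ℕ) {α : Type*} [MeasurableSpace α] {w u : α → I} {ω : α → Ω}
    {ζ : α → (ℕ → ℝ) × (ℕ → ℝ)} (hw : Measurable w) (hu : Measurable u) (hω : Measurable ω)
    (hζ : Measurable ζ) : Measurable fun a => fieldValue β s g h (w a) (u a) (ω a) (ζ a) j := by
  simp only [fieldValue_eq hs]
  refine ((hF.measurable_elim j).comp (hw.prodMk (hu.prodMk hω))).add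
    (((measurable_sum_elim_apply j).comp hζ).mul (Measurable.sqrt (measurable_const.sub ?_)))
  exact (continuous_covExt hβ j).measurable.comp (measurable_overlap hs hw hu hu)

/-- For fixed `w` and `u` the linear combination is a centered Gaussian variable whose variance is
the covariance form at `t`; evaluate its characteristic function at 1. -/
theorem IsFieldFamily.integral_exp_sum (hF : IsFieldFamily P β s g h) (hs : IsField s) (j : ℕ ⊕ ℕ)
    (w : I) (u : ℕ → I) (L : Finset ℕ) (t : ℕ → ℝ) :
    ∫ ω, Complex.exp ((∑ l ∈ L, t l * Sum.elim g h j w (u l) ω : ℝ) * Complex.I) ∂P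
      = Complex.exp (-((∑ l ∈ L, ∑ l' ∈ L, t l * (t l' * covExt β j (overlap s w (u l) (u l'))) : ℝ)
          : ℂ) / 2) := by
  have hG : IsGaussianProcess (fun l ω => t l * Sum.elim g h j w (u l) ω) P :=
    ((hF.gaussian_elim j w).comp_right u).smul t
  have hP := hG.isProbabilityMeasure
  have hsum : HasGaussianLaw (fun ω => ∑ l ∈ L, t l * Sum.elim g h j w (u l) ω) P :=
    hG.hasGaussianLaw_fun_sum
  have hint : ∀ l, MemLp (fun ω => t l * Sum.elim g h j w (u l) ω) 2 P := fun l =>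
    (hG.hasGaussianLaw_eval l).memLp_two
  have hch := hsum.charFun_map_eq 1
  rw [charFun_apply_real, integral_map hsum.aemeasurable
    (Continuous.aestronglyMeasurable (by fun_prop))] at hch
  have hvar : Var[fun ω => ∑ l ∈ L, t l * Sum.elim g h j w (u l) ω; P]
      = ∑ l ∈ L, ∑ l' ∈ L, t l * (t l' * covExt β j (overlap s w (u l) (u l'))) := by
    rw [variance_fun_sum' fun l _ => hint l]
    refine Finset.sum_congr rfl fun l _ => Finset.sum_congr rfl fun l' _ => ?_
    rw [covariance_const_mul_left, covariance_const_mul_right]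
    congr 2
    exact hF.cov_elim hs j w (u l) (u l')
  have hmean : ∫ ω, ∑ l ∈ L, t l * Sum.elim g h j w (u l) ω ∂P = 0 := by
    rw [integral_finsetSum _ fun l _ => (hint l).integrable (by norm_num)]
    refine Finset.sum_eq_zero fun l _ => ?_
    rw [integral_const_mul, hF.mean_elim, mul_zero]
  simp only [RCLike.inner_apply, conj_trivial, mul_one, hvar, hmean, Complex.ofReal_zero, zero_mul,
    zero_sub, Complex.ofReal_one, one_mul] at hch
  rw [hch, neg_div]

theorem IsFieldFamily.integral_exp_double_sum (hF : IsFieldFamily P β s g h) (hs : IsField s)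
    (w : I) (u : ℕ → I) (J : Finset (ℕ ⊕ ℕ)) (L : Finset ℕ) (t : ℕ ⊕ ℕ → ℕ → ℝ) :
    ∫ ω, Complex.exp ((∑ j ∈ J, ∑ l ∈ L, t j l * Sum.elim g h j w (u l) ω : ℝ) * Complex.I) ∂P
      = ∏ j ∈ J, Complex.exp (-((∑ l ∈ L, ∑ l' ∈ L,
          t j l * (t j l' * covExt β j (overlap s w (u l) (u l'))) : ℝ) : ℂ) / 2) := by
  let φ : ℕ ⊕ ℕ → (I → ℝ) → ℂ := fun j y =>
    Complex.exp ((∑ l ∈ L, t j l * y (u l) : ℝ) * Complex.I)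
  have hφ : ∀ j, Measurable (φ j) := fun j => by
    have : Measurable fun y : I → ℝ => (∑ l ∈ L, t j l * y (u l) : ℝ) :=
      Finset.measurable_sum _ fun l _ => (measurable_pi_apply _).const_mul _
    exact ((Complex.measurable_ofReal.comp this).mul_const _).cexp
  have hY : ∀ j, Measurable fun (ω : Ω) (u : I) => Sum.elim g h j w u ω := fun j =>
    measurable_pi_lambda _ fun u => (hF.measurable_elim j).comp
      (f := fun ω : Ω => (w, u, ω)) (by fun_prop)
  have hind := ((hF.indep w).comp φ hφ).precomp (Subtype.val_injective (p := fun j => j ∈ J))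
  have h' := hind.integral_fun_prod_eq_prod_integral
    (fun j => ((hφ j).comp (hY j)).aestronglyMeasurable)
  simp only [Function.comp_apply] at h'
  rw [Finset.prod_coe_sort J (fun j => ∫ ω, φ j (fun u => Sum.elim g h j w u ω) ∂P)] at h'
  simp_rw [← fun j => hF.integral_exp_sum hs j w u L (t j)]
  refine Eq.trans (integral_congr_ae (ae_of_all _ fun ω => ?_)) h'
  dsimp only
  rw [Complex.ofReal_sum, Finset.sum_mul, Complex.exp_sum,
    ← Finset.prod_coe_sort J]

end Fields

/-! ### Joint law of the fields of i.i.d. replicas -/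

instance : IsProbabilityMeasure gaussianSeq := by unfold gaussianSeq; infer_instance

instance : IsProbabilityMeasure replicaMeasure := by unfold replicaMeasure; infer_instance

/-- The law of the Gaussian variables `(z_i), (z'_k)` of a sequence of replicas. -/
noncomputable def replicaNoise : Measure (ℕ → (ℕ → ℝ) × (ℕ → ℝ)) :=
  Measure.infinitePi fun _ : ℕ => gaussianSeq.prod gaussianSeq

instance : IsProbabilityMeasure replicaNoise := by unfold replicaNoise; infer_instance

/-- The characteristic function of the fields of finitely many replicas, given the overlaps `R` and
the Gaussian variables `ζ` of the replicas. -/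
noncomputable def condCharFun (β : ℕ → ℝ) (J : Finset (ℕ ⊕ ℕ)) (L : Finset ℕ) (t : ℕ ⊕ ℕ → ℕ → ℝ)
    (R : ℕ × ℕ → ℝ) (ζ : ℕ → (ℕ → ℝ) × (ℕ → ℝ)) : ℂ :=
  Complex.exp ((∑ j ∈ J, ∑ l ∈ L, t j l * (Sum.elim (ζ l).1 (ζ l).2 j
      * Real.sqrt (covExt β j 1 - covExt β j (R (l, l)))) : ℝ) * Complex.I)
    * ∏ j ∈ J, Complex.exp (-((∑ l ∈ L, ∑ l' ∈ L,
        t j l * (t j l' * covExt β j (R (l, l'))) : ℝ) : ℂ) / 2)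

theorem measurable_condCharFun {β : ℕ → ℝ} (hβ : IsMixture β) (J : Finset (ℕ ⊕ ℕ)) (L : Finset ℕ)
    (t : ℕ ⊕ ℕ → ℕ → ℝ) :
    Measurable fun p : (ℕ × ℕ → ℝ) × (ℕ → (ℕ → ℝ) × (ℕ → ℝ)) => condCharFun β J L t p.1 p.2 := by
  have hcov : ∀ j a, Measurable fun p : (ℕ × ℕ → ℝ) × (ℕ → (ℕ → ℝ) × (ℕ → ℝ)) =>
      covExt β j (p.1 a) := fun j a =>
    (continuous_covExt hβ j).measurable.comp ((measurable_pi_apply a).comp measurable_fst)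
  have hz : ∀ j l, Measurable fun p : (ℕ × ℕ → ℝ) × (ℕ → (ℕ → ℝ) × (ℕ → ℝ)) =>
      (Sum.elim (p.2 l).1 (p.2 l).2 j : ℝ) := fun j l =>
    (measurable_sum_elim_apply j).comp ((measurable_pi_apply l).comp measurable_snd)
  refine Measurable.mul ?_ (Finset.measurable_prod _ fun j _ => ?_)
  · refine ((Complex.measurable_ofReal.comp ?_).mul_const _).cexp
    exact Finset.measurable_sum _ fun j _ => Finset.measurable_sum _ fun l _ =>
      ((hz j l).mul (measurable_const.sub (hcov j (l, l))).sqrt).const_mul _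
  · refine (Measurable.div_const (Measurable.neg (Complex.measurable_ofReal.comp ?_)) _).cexp
    exact Finset.measurable_sum _ fun l _ => Finset.measurable_sum _ fun l' _ =>
      ((hcov j (l, l')).const_mul _).const_mul _

theorem measurable_overlapArray {s : I → I → I → ℝ} (hs : IsField s) :
    Measurable fun (p : I × (ℕ → I)) (a : ℕ × ℕ) => overlap s p.1 (p.2 a.1) (p.2 a.2) :=
  measurable_pi_lambda _ fun a => measurable_overlap hs (by fun_prop) (by fun_prop) (by fun_prop)

section FieldArray

variable {Ω : Type} [MeasurableSpace Ω] {P : Measure Ω} {β : ℕ → ℝ} {s : I → I → I → ℝ}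
  {g h : ℕ → I → I → Ω → ℝ}

/-- Once `w`, `u` and the noises are fixed, the noise part is a constant phase and the rest is
Gaussian in `ω`. Everything depends on `w` and `u` through the overlaps alone, the diagonal ones
included. -/
theorem IsFieldFamily.integral_exp_fieldValue (hF : IsFieldFamily P β s g h) (hs : IsField s)
    (w : I) (u : ℕ → I) (ζ : ℕ → (ℕ → ℝ) × (ℕ → ℝ)) (J : Finset (ℕ ⊕ ℕ)) (L : Finset ℕ)
    (t : ℕ ⊕ ℕ → ℕ → ℝ) :
    ∫ ω, Complex.exp ((∑ j ∈ J, ∑ l ∈ L, t j l * fieldValue β s g h w (u l) ω (ζ l) j : ℝ)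
        * Complex.I) ∂P
      = condCharFun β J L t (fun a => overlap s w (u a.1) (u a.2)) ζ := by
  rw [condCharFun, ← hF.integral_exp_double_sum hs w u J L t, ← integral_const_mul]
  refine integral_congr_ae (ae_of_all _ fun ω => ?_)
  dsimp only
  rw [← Complex.exp_add, ← add_mul, ← Complex.ofReal_add, ← Finset.sum_add_distrib]
  congr 3
  refine Finset.sum_congr rfl fun j _ => ?_
  rw [← Finset.sum_add_distrib]
  refine Finset.sum_congr rfl fun l _ => ?_
  rw [fieldValue_eq hs]
  ring

/-- The fields of an i.i.d. sequence of replicas. -/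
noncomputable def fieldArray (β : ℕ → ℝ) (s : I → I → I → ℝ) (g h : ℕ → I → I → Ω → ℝ)
    (q : (I × Ω) × ((ℕ → I) × (ℕ → (ℕ → ℝ) × (ℕ → ℝ)))) (e : (ℕ ⊕ ℕ) × ℕ) : ℝ :=
  fieldValue β s g h q.1.1 (q.2.1 e.2) q.1.2 (q.2.2 e.2) e.1

theorem IsFieldFamily.measurable_fieldArray (hF : IsFieldFamily P β s g h) (hβ : IsMixture β)
    (hs : IsField s) : Measurable (fieldArray β s g h) :=
  measurable_pi_lambda _ fun e => hF.measurable_fieldValue hβ hs e.1 (by fun_prop) (by fun_prop)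
    (by fun_prop) (by fun_prop)

/-- The joint law of the fields of an i.i.d. sequence of replicas. -/
noncomputable def fieldArrayLaw (P : Measure Ω) (β : ℕ → ℝ) (s : I → I → I → ℝ)
    (g h : ℕ → I → I → Ω → ℝ) : Measure ((ℕ ⊕ ℕ) × ℕ → ℝ) :=
  Measure.map (fieldArray β s g h)
    (((volume : Measure I).prod P).prod ((uniformSeq ℕ).prod replicaNoise))

theorem norm_exp_ofReal_mul_I_le (x : ℝ) : ‖Complex.exp (x * Complex.I)‖ ≤ 1 :=
  (Complex.norm_exp_ofReal_mul_I x).le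

/-- Puts `ω` innermost, since the Gaussian computation is made for fixed `w`, `u` and `ζ`. -/
theorem integral_prod_prod_comm {A Ω U Z : Type*} [MeasurableSpace A] [MeasurableSpace Ω]
    [MeasurableSpace U] [MeasurableSpace Z] {μ : Measure A} {P : Measure Ω} {ν : Measure U}
    {γ : Measure Z} [IsProbabilityMeasure μ] [IsProbabilityMeasure P] [IsProbabilityMeasure ν]
    [IsProbabilityMeasure γ] {E : A → U → Z → Ω → ℂ}
    (hE : Measurable fun p : (A × Ω) × (U × Z) => E p.1.1 p.2.1 p.2.2 p.1.2)
    (hb : ∀ w u ζ ω, ‖E w u ζ ω‖ ≤ 1) :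
    ∫ p, E p.1.1 p.2.1 p.2.2 p.1.2 ∂((μ.prod P).prod (ν.prod γ))
      = ∫ w, ∫ u, ∫ ζ, ∫ ω, E w u ζ ω ∂P ∂γ ∂ν ∂μ := by
  rw [integral_prod _ (Integrable.of_bound (C := 1) hE.aestronglyMeasurable
    (ae_of_all _ fun _ => hb _ _ _ _)), integral_prod]
  swap
  · refine Integrable.of_bound (C := 1) (StronglyMeasurable.aestronglyMeasurable ?_)
      (ae_of_all _ fun p => ?_)
    · exact hE.stronglyMeasurable.integral_prod_right'
    · simpa using norm_integral_le_of_norm_le_const (μ := ν.prod γ)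
        (ae_of_all _ fun x : U × Z => hb p.1 x.1 x.2 p.2)
  refine integral_congr_ae (ae_of_all _ fun w => ?_)
  have hw : Measurable fun q : Ω × (U × Z) => E w q.2.1 q.2.2 q.1 :=
    hE.comp (f := fun q : Ω × (U × Z) => ((w, q.1), q.2)) (by fun_prop)
  dsimp only
  rw [integral_integral_swap (f := fun ω (q : U × Z) => E w q.1 q.2 ω)
    (Integrable.of_bound (C := 1) hw.aestronglyMeasurable
    (ae_of_all _ fun _ => hb _ _ _ _)), integral_prod]
  refine Integrable.of_bound (C := 1) (StronglyMeasurable.aestronglyMeasurable ?_)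
    (ae_of_all _ fun p => ?_)
  · exact (hw.comp measurable_swap).stronglyMeasurable.integral_prod_right'
  · simpa using norm_integral_le_of_norm_le_const (μ := P) (ae_of_all _ fun ω => hb w p.1 p.2 ω)

theorem IsFieldFamily.charFun_fieldArrayLaw [IsProbabilityMeasure P]
    (hF : IsFieldFamily P β s g h) (hβ : IsMixture β) (hs : IsField s) (J : Finset (ℕ ⊕ ℕ))
    (L : Finset ℕ) (t : ℕ ⊕ ℕ → ℕ → ℝ) :
    ∫ x, Complex.exp ((∑ j ∈ J, ∑ l ∈ L, t j l * x (j, l) : ℝ) * Complex.I)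
        ∂(fieldArrayLaw P β s g h)
      = ∫ R, ∫ ζ, condCharFun β J L t R ζ ∂replicaNoise ∂(overlapLaw s) := by
  have hE : Measurable fun p : (I × Ω) × ((ℕ → I) × (ℕ → (ℕ → ℝ) × (ℕ → ℝ))) =>
      Complex.exp ((∑ j ∈ J, ∑ l ∈ L,
        t j l * fieldValue β s g h p.1.1 (p.2.1 l) p.1.2 (p.2.2 l) j : ℝ) * Complex.I) := by
    refine ((Complex.measurable_ofReal.comp ?_).mul_const _).cexp
    exact Finset.measurable_sum _ fun j _ => Finset.measurable_sum _ fun l _ =>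
      (hF.measurable_fieldValue hβ hs j (by fun_prop) (by fun_prop) (by fun_prop)
        (by fun_prop)).const_mul _
  -- This bound is available only at actual overlaps, where the formula is a characteristic
  -- function; for an arbitrary array `R` the quadratic forms could be negative.
  have hCb : ∀ w (u : ℕ → I) ζ,
      ‖condCharFun β J L t (fun a => overlap s w (u a.1) (u a.2)) ζ‖ ≤ 1 := fun w u ζ => by
    rw [← hF.integral_exp_fieldValue hs]
    simpa using norm_integral_le_of_norm_le_const (μ := P)
      (ae_of_all _ fun ω => norm_exp_ofReal_mul_I_le (∑ j ∈ J, ∑ l ∈ L,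
        t j l * fieldValue β s g h w (u l) ω (ζ l) j))
  have hR := measurable_overlapArray hs
  have hCi : StronglyMeasurable fun R => ∫ ζ, condCharFun β J L t R ζ ∂replicaNoise :=
    (measurable_condCharFun hβ J L t).stronglyMeasurable.integral_prod_right'
  have hexp : Measurable fun x : (ℕ ⊕ ℕ) × ℕ → ℝ =>
      Complex.exp ((∑ j ∈ J, ∑ l ∈ L, t j l * x (j, l) : ℝ) * Complex.I) := by
    refine ((Complex.measurable_ofReal.comp ?_).mul_const _).cexp
    fun_prop
  rw [fieldArrayLaw, integral_map (hF.measurable_fieldArray hβ hs).aemeasurable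
    hexp.aestronglyMeasurable, overlapLaw, integral_map hR.aemeasurable hCi.aestronglyMeasurable]
  have key := integral_prod_prod_comm (μ := (volume : Measure I)) (P := P) (ν := uniformSeq ℕ)
    (γ := replicaNoise) (E := fun w u ζ ω => Complex.exp ((∑ j ∈ J, ∑ l ∈ L,
    t j l * fieldValue β s g h w (u l) ω (ζ l) j : ℝ) * Complex.I)) hE
    fun _ _ _ _ => norm_exp_ofReal_mul_I_le _
  simp only [hF.integral_exp_fieldValue hs] at key
  simp only [fieldArray]
  rw [key, integral_prod]
  refine Integrable.of_bound (C := 1) (hCi.comp_measurable hR).aestronglyMeasurable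
    (ae_of_all _ fun p => ?_)
  simpa using norm_integral_le_of_norm_le_const (μ := replicaNoise) (ae_of_all _ (hCb p.1 p.2))

end FieldArray

/-- The overlaps determine the joint law of the fields of the replicas. -/
theorem fieldArrayLaw_eq {Ω Ω' : Type} [MeasurableSpace Ω] [MeasurableSpace Ω'] {P : Measure Ω}
    {P' : Measure Ω'} [IsProbabilityMeasure P] [IsProbabilityMeasure P'] {β : ℕ → ℝ}
    {s s' : I → I → I → ℝ} {g h : ℕ → I → I → Ω → ℝ} {g' h' : ℕ → I → I → Ω' → ℝ}
    (hβ : IsMixture β) (hs : IsField s) (hs' : IsField s') (hF : IsFieldFamily P β s g h)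
    (hF' : IsFieldFamily P' β s' g' h') (hR : overlapLaw s = overlapLaw s') :
    fieldArrayLaw P β s g h = fieldArrayLaw P' β s' g' h' := by
  classical
  have : IsProbabilityMeasure (fieldArrayLaw P β s g h) :=
    Measure.isProbabilityMeasure_map (hF.measurable_fieldArray hβ hs).aemeasurable
  have : IsProbabilityMeasure (fieldArrayLaw P' β s' g' h') :=
    Measure.isProbabilityMeasure_map (hF'.measurable_fieldArray hβ hs').aemeasurable
  refine measure_ext_of_charFun fun S t => ?_
  -- Enlarge `S` to a rectangle, with coefficient zero off `S`, to match the double sum over fields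
  -- and replicas.
  have hS : ∀ x : (ℕ ⊕ ℕ) × ℕ → ℝ, ∑ e ∈ S, t e * x e
      = ∑ j ∈ S.image Prod.fst, ∑ l ∈ S.image Prod.snd,
        (if (j, l) ∈ S then t (j, l) else 0) * x (j, l) := by
    intro x
    rw [← Finset.sum_product (s := S.image Prod.fst) (t := S.image Prod.snd)
      (f := fun e => (if e ∈ S then t e else 0) * x e)]
    refine Eq.trans (Finset.sum_congr rfl fun e he => by rw [if_pos he])
      (Finset.sum_subset (s₁ := S) (f := fun e => (if e ∈ S then t e else 0) * x e) ?_ ?_)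
    · exact fun e he => Finset.mem_product.2
        ⟨Finset.mem_image_of_mem _ he, Finset.mem_image_of_mem _ he⟩
    · intro e _ he
      rw [if_neg he, zero_mul]
  simp only [hS]
  rw [hF.charFun_fieldArrayLaw hβ hs _ _ (fun j l => if (j, l) ∈ S then t (j, l) else 0),
    hF'.charFun_fieldArrayLaw hβ hs' _ _ (fun j l => if (j, l) ∈ S then t (j, l) else 0), hR]

/-! ### Ratios of averages as limits over i.i.d. samples -/

section StrongLaw

variable {X : Type*} [MeasurableSpace X] {ρ : Measure X} [IsProbabilityMeasure ρ]

theorem ae_tendsto_average_infinitePi {f : X → ℝ} (hf : Measurable f) (hi : Integrable f ρ) :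
    ∀ᵐ x ∂(Measure.infinitePi fun _ : ℕ => ρ),
      Tendsto (fun N : ℕ => (∑ l ∈ Finset.range N, f (x l)) / N) atTop (𝓝 (∫ y, f y ∂ρ)) := by
  have hmp := fun l => measurePreserving_eval_infinitePi (fun _ : ℕ => ρ) l
  have hind : iIndepFun (fun (l : ℕ) (x : ℕ → X) => f (x l)) (Measure.infinitePi fun _ => ρ) :=
    iIndepFun_infinitePi (P := fun _ : ℕ => ρ) (X := fun _ => f) fun _ => hf
  have hmap : ∀ l, (Measure.infinitePi fun _ : ℕ => ρ).map (fun x => f (x l)) = ρ.map f := by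
    intro l
    conv_rhs => rw [← (hmp l).map_eq, Measure.map_map hf (measurable_pi_apply l)]
    rfl
  have h := strong_law_ae_real (μ := Measure.infinitePi fun _ : ℕ => ρ)
    (fun (l : ℕ) (x : ℕ → X) => f (x l)) ((hmp 0).integrable_comp_of_integrable hi)
    (fun i j hij => hind.indepFun hij) (fun l => ⟨(hf.comp (measurable_pi_apply l)).aemeasurable,
      (hf.comp (measurable_pi_apply 0)).aemeasurable, by rw [hmap l, hmap 0]⟩)
  have hint : ∫ x : ℕ → X, f (x 0) ∂(Measure.infinitePi fun _ : ℕ => ρ) = ∫ y, f y ∂ρ := by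
    conv_rhs => rw [← (hmp 0).map_eq]
    exact (integral_map (measurable_pi_apply 0).aemeasurable hf.aestronglyMeasurable).symm
  rw [hint] at h
  exact h

/-- `(∏_a ∑_{l < N} t_{a,l} d_l) / (∑_{l < N} d_l)^q`. -/
noncomputable def sampleRatio {q : ℕ} (t : Fin q → ℕ → ℝ) (d : ℕ → ℝ) (N : ℕ) : ℝ :=
  (∏ a, ∑ l ∈ Finset.range N, t a l * d l) / (∑ l ∈ Finset.range N, d l) ^ q

theorem abs_sampleRatio_le {q : ℕ} {t : Fin q → ℕ → ℝ} {d : ℕ → ℝ} (ht : ∀ a l, |t a l| ≤ 1)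
    (hd : ∀ l, 0 ≤ d l) (N : ℕ) : |sampleRatio t d N| ≤ 1 := by
  have hS : 0 ≤ ∑ l ∈ Finset.range N, d l := Finset.sum_nonneg fun l _ => hd l
  rw [sampleRatio, abs_div, abs_of_nonneg (pow_nonneg hS q)]
  refine div_le_one_of_le₀ ?_ (pow_nonneg hS q)
  rw [Finset.abs_prod]
  calc ∏ a, |∑ l ∈ Finset.range N, t a l * d l| ≤ ∏ _a : Fin q, ∑ l ∈ Finset.range N, d l := by
        refine Finset.prod_le_prod (fun _ _ => abs_nonneg _) fun a _ => ?_
        refine (Finset.abs_sum_le_sum_abs _ _).trans (Finset.sum_le_sum fun l _ => ?_)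
        rw [abs_mul, abs_of_nonneg (hd l)]
        exact mul_le_of_le_one_left (hd l) (ht a l)
    _ = _ := by simp

theorem measurable_sampleRatio {q : ℕ} {α : Type*} [MeasurableSpace α] {t : α → Fin q → ℕ → ℝ}
    {d : α → ℕ → ℝ} (ht : ∀ a l, Measurable fun x => t x a l) (hd : ∀ l, Measurable fun x => d x l)
    (N : ℕ) : Measurable fun x => sampleRatio (t x) (d x) N :=
  (Finset.measurable_prod _ fun a _ => Finset.measurable_sum _ fun l _ => (ht a l).mul (hd l)).div
    ((Finset.measurable_sum _ fun l _ => hd l).pow_const q)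

/-- Divide numerator and denominator by `N^q` and apply the strong law to each factor; the limiting
denominator is positive. As `|T| ≤ 1`, the ratio is bounded by 1, so dominated convergence needs no
control of inverse moments of `D`. -/
theorem tendsto_integral_sampleRatio {q : ℕ} {T : Fin q → X → ℝ} {D : X → ℝ}
    (hT : ∀ a, Measurable (T a)) (hD : Measurable D) (hT1 : ∀ a x, |T a x| ≤ 1)
    (hD0 : ∀ x, 0 < D x) (hDi : Integrable D ρ) :
    Tendsto (fun N => ∫ x : ℕ → X, sampleRatio (fun a l => T a (x l)) (fun l => D (x l)) N
        ∂(Measure.infinitePi fun _ : ℕ => ρ)) atTop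
      (𝓝 ((∏ a, ∫ y, T a y * D y ∂ρ) / (∫ y, D y ∂ρ) ^ q)) := by
  have hTi : ∀ a, Integrable (fun y => T a y * D y) ρ := fun a =>
    hDi.bdd_mul (c := 1) (hT a).aestronglyMeasurable (ae_of_all _ (hT1 a))
  have hpos : 0 < ∫ y, D y ∂ρ := by
    rw [integral_pos_iff_support_of_nonneg (fun x => (hD0 x).le) hDi,
      show Function.support D = Set.univ from Set.eq_univ_of_forall fun x => (hD0 x).ne']
    simp
  have hlim : ∀ᵐ x ∂(Measure.infinitePi fun _ : ℕ => ρ),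
      Tendsto (fun N => sampleRatio (fun a l => T a (x l)) (fun l => D (x l)) N) atTop
        (𝓝 ((∏ a, ∫ y, T a y * D y ∂ρ) / (∫ y, D y ∂ρ) ^ q)) := by
    filter_upwards [ae_tendsto_average_infinitePi hD hDi, ae_all_iff.2 fun a =>
      ae_tendsto_average_infinitePi ((hT a).mul hD) (hTi a)] with x h1 h2
    have h3 := (tendsto_finsetProd Finset.univ fun a _ => h2 a).div (h1.pow q)
      (pow_ne_zero q hpos.ne')
    refine h3.congr' ?_
    filter_upwards [eventually_gt_atTop 0] with N hN
    have hN' : (N : ℝ) ^ q ≠ 0 := pow_ne_zero q (Nat.cast_ne_zero.2 hN.ne')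
    simp only [Pi.div_apply, Pi.mul_apply]
    rw [Finset.prod_div_distrib, Finset.prod_const, Finset.card_univ, Fintype.card_fin, div_pow,
      div_div_div_cancel_right₀ hN', sampleRatio]
  have h := tendsto_integral_of_dominated_convergence (μ := Measure.infinitePi fun _ : ℕ => ρ)
    (F := fun N x => sampleRatio (fun a l => T a (x l)) (fun l => D (x l)) N) (fun _ => 1)
    (fun N => (measurable_sampleRatio (fun a l => (hT a).comp (measurable_pi_apply l))
      (fun l => hD.comp (measurable_pi_apply l)) N).aestronglyMeasurable)
    (integrable_const _) (fun N => ae_of_all _ fun x =>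
      abs_sampleRatio_le (fun a l => hT1 a (x l)) (fun l => (hD0 (x l)).le) N) hlim
  simpa using h

end StrongLaw

/-! ### Integrability of the density -/

/-- `exp (∑_{i < n} log ch y_i + ∑_{k < r} y'_k)`. -/
noncomputable def expDensity (n r : ℕ) (y : ℕ ⊕ ℕ → ℝ) : ℝ :=
  Real.exp (∑ i ∈ Finset.range n, Real.log (Real.cosh (y (.inl i)))
    + ∑ k ∈ Finset.range r, y (.inr k))

theorem measurable_expDensity (n r : ℕ) : Measurable (expDensity n r) := by
  unfold expDensity
  refine (Measurable.add ?_ ?_).exp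
  · exact Finset.measurable_sum _ fun i _ =>
      (Real.continuous_cosh.measurable.comp (measurable_pi_apply _)).log
  · exact Finset.measurable_sum _ fun i _ => measurable_pi_apply _

theorem log_cosh_le_abs (x : ℝ) : Real.log (Real.cosh x) ≤ |x| := by
  rw [Real.log_le_iff_le_exp (Real.cosh_pos x), ← Real.cosh_abs, Real.cosh_eq]
  have : Real.exp (-|x|) ≤ Real.exp |x| := Real.exp_le_exp.2 (by linarith [abs_nonneg x])
  linarith

/-- The sum is at most the number of terms times the largest one. This reduces a joint exponential
moment to moments of single fields, without using their independence. -/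
theorem exp_sum_le_sum_exp {ι : Type*} {A : Finset ι} (hA : A.Nonempty) (x : ι → ℝ) :
    Real.exp (∑ j ∈ A, x j) ≤ ∑ j ∈ A, Real.exp (A.card * x j) := by
  obtain ⟨a, ha, hmax⟩ := A.exists_max_image x hA
  have h1 : ∑ j ∈ A, x j ≤ A.card * x a := by
    simpa using Finset.sum_le_card_nsmul A x (x a) hmax
  exact (Real.exp_le_exp.2 h1).trans (Finset.single_le_sum
    (f := fun j => Real.exp (A.card * x j)) (fun j _ => (Real.exp_pos _).le) ha)

theorem exp_abs_le (x : ℝ) : Real.exp |x| ≤ Real.exp x + Real.exp (-x) := by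
  rcases abs_choice x with h | h <;> rw [h] <;> linarith [Real.exp_pos x, Real.exp_pos (-x)]

theorem exp_add_le (x y : ℝ) : Real.exp (x + y) ≤ Real.exp (2 * x) + Real.exp (2 * y) := by
  rcases le_total x y with h | h
  · have : Real.exp (x + y) ≤ Real.exp (2 * y) := Real.exp_le_exp.2 (by linarith)
    linarith [Real.exp_pos (2 * x)]
  · have : Real.exp (x + y) ≤ Real.exp (2 * x) := Real.exp_le_exp.2 (by linarith)
    linarith [Real.exp_pos (2 * y)]

/-- Separates process from noise; the uniform `b` replaces the coefficient `c`, which will depend on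
`w` and `u`. -/
theorem exp_mul_abs_add_mul_le {K b c y z : ℝ} (hK : 0 ≤ K) (hc : 0 ≤ c) (hcb : c ≤ b) :
    Real.exp (K * |y + z * c|) ≤ (Real.exp ((2 * K) * y) + Real.exp ((-(2 * K)) * y))
      + (Real.exp ((2 * (K * b)) * z) + Real.exp ((-(2 * (K * b))) * z)) := by
  have hb : 0 ≤ b := hc.trans hcb
  have h1 : K * |y + z * c| ≤ K * |y| + K * b * |z| := by
    have : |y + z * c| ≤ |y| + b * |z| := by
      refine (abs_add_le _ _).trans ?_
      rw [abs_mul, abs_of_nonneg hc]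
      nlinarith [abs_nonneg z]
    calc K * |y + z * c| ≤ K * (|y| + b * |z|) := mul_le_mul_of_nonneg_left this hK
      _ = _ := by ring
  have h2 := exp_abs_le (2 * K * y)
  have h3 := exp_abs_le (2 * (K * b) * z)
  rw [abs_mul, abs_of_nonneg (by positivity : 0 ≤ 2 * K)] at h2
  rw [abs_mul, abs_of_nonneg (by positivity : 0 ≤ 2 * (K * b))] at h3
  refine (Real.exp_le_exp.2 h1).trans ((exp_add_le _ _).trans ?_)
  rw [neg_mul, neg_mul, show 2 * (K * |y|) = 2 * K * |y| by ring,
    show 2 * (K * b * |z|) = 2 * (K * b) * |z| by ring]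
  linarith

theorem expDensity_le {n r : ℕ} (hn : 1 ≤ n) (y : ℕ ⊕ ℕ → ℝ) :
    expDensity n r y ≤ ∑ j ∈ (Finset.range n).disjSum (Finset.range r),
      Real.exp (((Finset.range n).disjSum (Finset.range r)).card * |y j|) := by
  refine le_trans (Real.exp_le_exp.2 ?_) (exp_sum_le_sum_exp ⟨.inl 0, by simp; omega⟩ _)
  rw [Finset.sum_disjSum]
  exact add_le_add (Finset.sum_le_sum fun i _ => log_cosh_le_abs _)
    (Finset.sum_le_sum fun k _ => le_abs_self _)

theorem measurePreserving_replica_noise (j : ℕ ⊕ ℕ) :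
    MeasurePreserving (fun ζ : (ℕ → ℝ) × (ℕ → ℝ) => (Sum.elim ζ.1 ζ.2 j : ℝ))
      (gaussianSeq.prod gaussianSeq) (gaussianReal 0 1) := by
  have hev : ∀ i : ℕ, MeasurePreserving (fun z : ℕ → ℝ => z i) gaussianSeq (gaussianReal 0 1) :=
    fun i => measurePreserving_eval_infinitePi (fun _ : ℕ => gaussianReal 0 1) i
  cases j with
  | inl i => exact (hev i).comp (measurePreserving_fst (μ := gaussianSeq) (ν := gaussianSeq))
  | inr k => exact (hev k).comp (measurePreserving_snd (μ := gaussianSeq) (ν := gaussianSeq))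

section Density

variable {Ω : Type} [MeasurableSpace Ω] {P : Measure Ω} {β : ℕ → ℝ} {s : I → I → I → ℝ}
  {g h : ℕ → I → I → Ω → ℝ}

theorem IsFieldFamily.measurable_density (hF : IsFieldFamily P β s g h) (hβ : IsMixture β)
    (hs : IsField s) (n r : ℕ) :
    Measurable fun p : (I × Ω) × (I × (ℕ → ℝ) × (ℕ → ℝ)) =>
      expDensity n r (fieldValue β s g h p.1.1 p.2.1 p.1.2 p.2.2) :=
  (measurable_expDensity n r).comp (measurable_pi_lambda _ fun j =>
    hF.measurable_fieldValue hβ hs j (by fun_prop) (by fun_prop) (by fun_prop) (by fun_prop))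

variable [IsProbabilityMeasure P]

theorem measurePreserving_shuffle (P : Measure Ω) [IsProbabilityMeasure P] :
    MeasurePreserving
      (fun p : (I × Ω) × (I × (ℕ → ℝ) × (ℕ → ℝ)) => ((p.1.1, p.2.1), p.1.2))
      (((volume : Measure I).prod P).prod replicaMeasure)
      (((volume : Measure I).prod (volume : Measure I)).prod P) := by
  have h1 : MeasurePreserving (Prod.map id Prod.fst : (I × Ω) × (I × (ℕ → ℝ) × (ℕ → ℝ)) → _)
      (((volume : Measure I).prod P).prod replicaMeasure)
      (((volume : Measure I).prod P).prod (volume : Measure I)) :=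
    (MeasurePreserving.id _).prod measurePreserving_fst
  have h2 := (measurePreserving_prodAssoc (volume : Measure I) P (volume : Measure I)).comp h1
  have h3 := ((MeasurePreserving.id (volume : Measure I)).prod
    (Measure.measurePreserving_swap (μ := P) (ν := (volume : Measure I)))).comp h2
  exact ((measurePreserving_prodAssoc (volume : Measure I) (volume : Measure I) P).symm _).comp h3

/-- For fixed `(w, u)` this is the moment generating function of a centered Gaussian of variance at
most `B`, hence at most `exp (B a² / 2)` uniformly in `(w, u)`. -/
theorem IsFieldFamily.integrable_exp_mul (hF : IsFieldFamily P β s g h) (hs : IsField s) {B : ℝ}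
    (hB : ∀ j, ∀ x ∈ Set.Icc (-1 : ℝ) 1, |covFun β j x| ≤ B) (j : ℕ ⊕ ℕ) (a : ℝ) :
    Integrable (fun p : (I × Ω) × (I × (ℕ → ℝ) × (ℕ → ℝ)) =>
      Real.exp (a * Sum.elim g h j p.1.1 p.2.1 p.1.2))
      (((volume : Measure I).prod P).prod replicaMeasure) := by
  have hm : Measurable fun q : (I × I) × Ω => Real.exp (a * Sum.elim g h j q.1.1 q.1.2 q.2) :=
    (((hF.measurable_elim j).comp (f := fun q : (I × I) × Ω => (q.1.1, q.1.2, q.2))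
      (by fun_prop)).const_mul a).exp
  suffices H : Integrable (fun q : (I × I) × Ω => Real.exp (a * Sum.elim g h j q.1.1 q.1.2 q.2))
      (((volume : Measure I).prod (volume : Measure I)).prod P) from
    (measurePreserving_shuffle P).integrable_comp_of_integrable H
  have hlaw : ∀ w u, P.map (Sum.elim g h j w u)
      = gaussianReal 0 (covExt β j (overlap s w u u)).toNNReal := by
    intro w u
    have hG := (hF.gaussian_elim j w).hasGaussianLaw_eval u
    rw [hG.map_eq_gaussianReal, hF.mean_elim, ← covariance_self hG.aemeasurable, hF.cov_elim hs]
  have hae : ∀ w u, AEMeasurable (Sum.elim g h j w u) P := fun w u =>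
    ((hF.gaussian_elim j w).hasGaussianLaw_eval u).aemeasurable
  rw [integrable_prod_iff hm.aestronglyMeasurable]
  constructor
  · refine ae_of_all _ fun p => ?_
    have := integrable_exp_mul_gaussianReal (μ := 0)
      (v := (covExt β j (overlap s p.1 p.2 p.2)).toNNReal) a
    rw [← hlaw] at this
    exact this.comp_aemeasurable (hae p.1 p.2)
  · refine Integrable.of_bound (C := Real.exp (B * a ^ 2 / 2))
      (measurable_integral_prod_right hm.norm).aestronglyMeasurable (ae_of_all _ fun p => ?_)
    rw [Real.norm_eq_abs, abs_of_nonneg (integral_nonneg fun _ => norm_nonneg _)]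
    simp only [Real.norm_eq_abs, Real.abs_exp]
    have := mgf_gaussianReal (hlaw p.1 p.2) a
    rw [mgf] at this
    rw [this, zero_mul, zero_add]
    refine Real.exp_le_exp.2 ?_
    have hle : ((covExt β j (overlap s p.1 p.2 p.2)).toNNReal : ℝ) ≤ B := by
      have h1 := hB j _ (overlap_mem_Icc hs p.1 p.2 p.2)
      rw [Real.coe_toNNReal', covExt_of_mem j (overlap_mem_Icc hs _ _ _)]
      exact max_le ((le_abs_self _).trans h1) ((abs_nonneg _).trans h1)
    gcongr

theorem integrable_exp_mul_noise (j : ℕ ⊕ ℕ) (a : ℝ) :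
    Integrable (fun p : (I × Ω) × (I × (ℕ → ℝ) × (ℕ → ℝ)) =>
      Real.exp (a * Sum.elim p.2.2.1 p.2.2.2 j))
      (((volume : Measure I).prod P).prod replicaMeasure) := by
  have h1 : MeasurePreserving (fun p : (I × Ω) × (I × (ℕ → ℝ) × (ℕ → ℝ)) =>
      (Sum.elim p.2.2.1 p.2.2.2 j : ℝ)) (((volume : Measure I).prod P).prod replicaMeasure)
      (gaussianReal 0 1) :=
    (measurePreserving_replica_noise j).comp
      ((measurePreserving_snd (μ := (volume : Measure I))
        (ν := gaussianSeq.prod gaussianSeq)).comp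
        (measurePreserving_snd (μ := (volume : Measure I).prod P) (ν := replicaMeasure)))
  exact h1.integrable_comp_of_integrable (integrable_exp_mul_gaussianReal a)

theorem IsFieldFamily.integrable_density (hF : IsFieldFamily P β s g h) (hβ : IsMixture β)
    (hs : IsField s) {n : ℕ} (hn : 1 ≤ n) (r : ℕ) :
    Integrable (fun p : (I × Ω) × (I × (ℕ → ℝ) × (ℕ → ℝ)) =>
      expDensity n r (fieldValue β s g h p.1.1 p.2.1 p.1.2 p.2.2))
      (((volume : Measure I).prod P).prod replicaMeasure) := by
  obtain ⟨B, hB0, hB⟩ := exists_abs_covFun_le hβ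
  set A := (Finset.range n).disjSum (Finset.range r) with hA
  set K : ℝ := (A.card : ℝ)
  -- The noise coefficient is the root of a difference of two values, each at most `B` in absolute
  -- value.
  set b : ℝ := Real.sqrt (2 * B)
  have hdom : Integrable (fun p : (I × Ω) × (I × (ℕ → ℝ) × (ℕ → ℝ)) =>
      ∑ j ∈ A, ((Real.exp ((2 * K) * Sum.elim g h j p.1.1 p.2.1 p.1.2)
          + Real.exp ((-(2 * K)) * Sum.elim g h j p.1.1 p.2.1 p.1.2))
        + (Real.exp ((2 * (K * b)) * Sum.elim p.2.2.1 p.2.2.2 j)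
          + Real.exp ((-(2 * (K * b))) * Sum.elim p.2.2.1 p.2.2.2 j))))
      (((volume : Measure I).prod P).prod replicaMeasure) :=
    integrable_finsetSum _ fun j _ =>
      ((hF.integrable_exp_mul hs hB j _).add (hF.integrable_exp_mul hs hB j _)).add
        ((integrable_exp_mul_noise j _).add (integrable_exp_mul_noise j _))
  refine hdom.mono' (hF.measurable_density hβ hs n r).aestronglyMeasurable
    (ae_of_all _ fun p => ?_)
  rw [Real.norm_eq_abs, abs_of_pos (show 0 < expDensity n r (fieldValue β s g h
    p.1.1 p.2.1 p.1.2 p.2.2) from Real.exp_pos _)]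
  refine (expDensity_le hn _).trans (Finset.sum_le_sum fun j _ => ?_)
  rw [fieldValue_eq hs]
  refine exp_mul_abs_add_mul_le (Nat.cast_nonneg _) (Real.sqrt_nonneg _) (Real.sqrt_le_sqrt ?_)
  have h1 := hB j _ (overlap_mem_Icc hs p.1.1 p.2.1 p.2.1)
  have h2 := hB j 1 (by norm_num)
  rw [covExt_of_mem j (overlap_mem_Icc hs _ _ _), covExt_of_mem j (by norm_num)]
  linarith [neg_abs_le (covFun β j (overlap s p.1.1 p.2.1 p.2.1)), le_abs_self (covFun β j 1)]

end Density

/-! ### Empirical ratios and their limit -/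

/-- `∏_{i ∈ C} th y_i`. -/
noncomputable def tanhProd (C : Finset ℕ) (y : ℕ ⊕ ℕ → ℝ) : ℝ := ∏ i ∈ C, Real.tanh (y (.inl i))

theorem measurable_tanhProd (C : Finset ℕ) : Measurable (tanhProd C) := by
  refine Finset.measurable_prod _ fun i _ => ?_
  have : Measurable Real.tanh := by
    have h : Real.tanh = fun x => Real.sinh x / Real.cosh x := funext Real.tanh_eq_sinh_div_cosh
    rw [h]
    exact Real.measurable_sinh.div Real.measurable_cosh
  exact this.comp (measurable_pi_apply _)

theorem abs_tanhProd_le (C : Finset ℕ) (y : ℕ ⊕ ℕ → ℝ) : |tanhProd C y| ≤ 1 := by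
  rw [tanhProd, Finset.abs_prod]
  exact Finset.prod_le_one (fun _ _ => abs_nonneg _) fun _ _ => (Real.abs_tanh_lt_one _).le

/-- The empirical version, over `N` replicas, of `∏_l U_l / V^q`. -/
noncomputable def empiricalRatio (n r : ℕ) {q : ℕ} (C : Fin q → Finset ℕ) (N : ℕ)
    (x : (ℕ ⊕ ℕ) × ℕ → ℝ) : ℝ :=
  sampleRatio (fun a l => tanhProd (C a) fun j => x (j, l))
    (fun l => expDensity n r fun j => x (j, l)) N

theorem measurable_empiricalRatio (n r : ℕ) {q : ℕ} (C : Fin q → Finset ℕ) (N : ℕ) :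
    Measurable (empiricalRatio n r C N) :=
  measurable_sampleRatio (fun a l => (measurable_tanhProd (C a)).comp (by fun_prop))
    (fun l => (measurable_expDensity n r).comp (by fun_prop)) N

theorem abs_empiricalRatio_le (n r : ℕ) {q : ℕ} (C : Fin q → Finset ℕ) (N : ℕ)
    (x : (ℕ ⊕ ℕ) × ℕ → ℝ) : |empiricalRatio n r C N x| ≤ 1 :=
  abs_sampleRatio_le (fun _ _ => abs_tanhProd_le _ _) (fun _ => (Real.exp_pos _).le) N

section Limit

variable {Ω : Type} {β : ℕ → ℝ} {s : I → I → I → ℝ} {g h : ℕ → I → I → Ω → ℝ}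

/-- With every index of `C` below `n`, the product of the `σ̄(w,u,v_i)` is empty, so `U` is a
function of the fields alone. -/
theorem numerU_eq {n : ℕ} {C : Finset ℕ} (hC : C ⊆ Finset.range n) (β : ℕ → ℝ)
    (s : I → I → I → ℝ) (g h : ℕ → I → I → Ω → ℝ) (r : ℕ) (w : I) (v : ℕ → I) (ω : Ω) :
    numerU β s g h n r C w v ω = ∫ ρ, tanhProd C (fieldValue β s g h w ρ.1 ω ρ.2)
      * expDensity n r (fieldValue β s g h w ρ.1 ω ρ.2) ∂replicaMeasure := by
  have h1 : C.filter (fun i => i < n) = C :=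
    Finset.filter_true_of_mem fun i hi => Finset.mem_range.1 (hC hi)
  have h2 : C.filter (fun i => n ≤ i) = ∅ :=
    Finset.filter_false_of_mem fun i hi => not_le.2 (Finset.mem_range.1 (hC hi))
  simp only [numerU, h1, h2, Finset.prod_empty, mul_one]
  rfl

variable [MeasurableSpace Ω] {P : Measure Ω}

/-- `∏_l U_l / V^q`, when only the coordinates below `n` occur. -/
noncomputable def limitRatio (β : ℕ → ℝ) (s : I → I → I → ℝ) (g h : ℕ → I → I → Ω → ℝ) (n r : ℕ)
    {q : ℕ} (C : Fin q → Finset ℕ) (p : I × Ω) : ℝ :=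
  (∏ a, ∫ ρ, tanhProd (C a) (fieldValue β s g h p.1 ρ.1 p.2 ρ.2)
      * expDensity n r (fieldValue β s g h p.1 ρ.1 p.2 ρ.2) ∂replicaMeasure)
    / (∫ ρ, expDensity n r (fieldValue β s g h p.1 ρ.1 p.2 ρ.2) ∂replicaMeasure) ^ q

theorem IsFieldFamily.measurable_limitRatio (hF : IsFieldFamily P β s g h)
    (hβ : IsMixture β) (hs : IsField s) (n r : ℕ) {q : ℕ} (C : Fin q → Finset ℕ) :
    Measurable (limitRatio β s g h n r C) := by
  have hD := hF.measurable_density hβ hs n r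
  have hT : ∀ a, Measurable fun p : (I × Ω) × (I × (ℕ → ℝ) × (ℕ → ℝ)) =>
      tanhProd (C a) (fieldValue β s g h p.1.1 p.2.1 p.1.2 p.2.2) := fun a =>
    (measurable_tanhProd (C a)).comp (measurable_pi_lambda _ fun j =>
      hF.measurable_fieldValue hβ hs j (by fun_prop) (by fun_prop) (by fun_prop) (by fun_prop))
  have hV : Measurable fun p : I × Ω =>
      ∫ ρ, expDensity n r (fieldValue β s g h p.1 ρ.1 p.2 ρ.2) ∂replicaMeasure :=
    measurable_integral_prod_right hD
  have hU : ∀ a, Measurable fun p : I × Ω =>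
      ∫ ρ, tanhProd (C a) (fieldValue β s g h p.1 ρ.1 p.2 ρ.2)
        * expDensity n r (fieldValue β s g h p.1 ρ.1 p.2 ρ.2) ∂replicaMeasure := fun a =>
    measurable_integral_prod_right ((hT a).mul hD)
  exact (Finset.measurable_prod _ fun a _ => hU a).div (hV.pow_const q)

theorem integral_zip_replicas {Φ : (ℕ → I × (ℕ → ℝ) × (ℕ → ℝ)) → ℝ} (hΦ : Measurable Φ) :
    ∫ x : (ℕ → I) × (ℕ → (ℕ → ℝ) × (ℕ → ℝ)), Φ (fun l => (x.1 l, x.2 l))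
        ∂((uniformSeq ℕ).prod replicaNoise)
      = ∫ ρ, Φ ρ ∂(Measure.infinitePi fun _ : ℕ => replicaMeasure) := by
  have h := map_zip_infinitePi (ι := ℕ) (volume : Measure I) (gaussianSeq.prod gaussianSeq)
  unfold replicaMeasure
  rw [← h, integral_map (Measurable.aemeasurable (by fun_prop)) hΦ.aestronglyMeasurable]
  rfl

theorem IsFieldFamily.tendsto_integral_empiricalRatio_fieldArray (hF : IsFieldFamily P β s g h)
    (hβ : IsMixture β) (hs : IsField s) {n r : ℕ} {q : ℕ} (C : Fin q → Finset ℕ) (p : I × Ω)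
    (hi : Integrable (fun ρ : I × (ℕ → ℝ) × (ℕ → ℝ) =>
      expDensity n r (fieldValue β s g h p.1 ρ.1 p.2 ρ.2)) replicaMeasure) :
    Tendsto (fun N => ∫ x, empiricalRatio n r C N (fieldArray β s g h (p, x))
      ∂((uniformSeq ℕ).prod replicaNoise)) atTop (𝓝 (limitRatio β s g h n r C p)) := by
  have hf : Measurable fun ρ : I × (ℕ → ℝ) × (ℕ → ℝ) => fieldValue β s g h p.1 ρ.1 p.2 ρ.2 :=
    measurable_pi_lambda _ fun j => hF.measurable_fieldValue hβ hs j (by fun_prop) (by fun_prop)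
      (by fun_prop) (by fun_prop)
  have hT : ∀ a, Measurable fun ρ : I × (ℕ → ℝ) × (ℕ → ℝ) =>
      tanhProd (C a) (fieldValue β s g h p.1 ρ.1 p.2 ρ.2) := fun a =>
    (measurable_tanhProd (C a)).comp hf
  have hD : Measurable fun ρ : I × (ℕ → ℝ) × (ℕ → ℝ) =>
      expDensity n r (fieldValue β s g h p.1 ρ.1 p.2 ρ.2) := (measurable_expDensity n r).comp hf
  have h := tendsto_integral_sampleRatio (ρ := replicaMeasure) hT hD
    (fun _ _ => abs_tanhProd_le _ _) (fun _ => Real.exp_pos _) hi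
  refine h.congr fun N => ?_
  exact (integral_zip_replicas (measurable_sampleRatio
    (fun a l => (hT a).comp (measurable_pi_apply l))
    (fun l => hD.comp (measurable_pi_apply l)) N)).symm

variable [IsProbabilityMeasure P]

/-- The strong law is applied over the replicas at fixed `(w, ω)`. It needs the density to be
integrable there, which Fubini gives for almost every `(w, ω)`; the bound by 1 then allows
integration over `(w, ω)`. -/
theorem IsFieldFamily.tendsto_integral_empiricalRatio (hF : IsFieldFamily P β s g h)
    (hβ : IsMixture β) (hs : IsField s) {n : ℕ} (hn : 1 ≤ n) (r : ℕ) {q : ℕ}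
    (C : Fin q → Finset ℕ) :
    Tendsto (fun N => ∫ x, empiricalRatio n r C N x ∂(fieldArrayLaw P β s g h)) atTop
      (𝓝 (∫ p, limitRatio β s g h n r C p ∂((volume : Measure I).prod P))) := by
  have hA := hF.measurable_fieldArray hβ hs
  have hE : ∀ N, Measurable fun q => empiricalRatio n r C N (fieldArray β s g h q) := fun N =>
    (measurable_empiricalRatio n r C N).comp hA
  have hrw : ∀ N, ∫ x, empiricalRatio n r C N x ∂(fieldArrayLaw P β s g h)
      = ∫ p, ∫ x, empiricalRatio n r C N (fieldArray β s g h (p, x))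
          ∂((uniformSeq ℕ).prod replicaNoise) ∂((volume : Measure I).prod P) := by
    intro N
    rw [fieldArrayLaw, integral_map hA.aemeasurable
      (measurable_empiricalRatio n r C N).aestronglyMeasurable, integral_prod]
    exact Integrable.of_bound (C := 1) (hE N).aestronglyMeasurable
      (ae_of_all _ fun _ => abs_empiricalRatio_le _ _ _ _ _)
  simp only [hrw]
  refine tendsto_integral_of_dominated_convergence (fun _ => 1)
    (fun N => (measurable_integral_prod_right (hE N)).aestronglyMeasurable) (integrable_const _)
    (fun N => ae_of_all _ fun p => abs_integral_le_of_abs_le fun x =>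
      abs_empiricalRatio_le _ _ _ _ _) ?_
  filter_upwards [(hF.integrable_density hβ hs hn r).prod_right_ae] with p hp
  exact hF.tendsto_integral_empiricalRatio_fieldArray hβ hs C p hp

theorem IsFieldFamily.integral_ratio_eq (hF : IsFieldFamily P β s g h) (hβ : IsMixture β)
    (hs : IsField s) (n r : ℕ) {q : ℕ} {C : Fin q → Finset ℕ} (hC : ∀ l, C l ⊆ Finset.range n) :
    ∫ p : I × (ℕ → I) × Ω, (∏ l : Fin q, numerU β s g h n r (C l) p.1 p.2.1 p.2.2)
        / denomV β s g h n r p.1 p.2.2 ^ q ∂((volume : Measure I).prod ((uniformSeq ℕ).prod P))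
      = ∫ p, limitRatio β s g h n r C p ∂((volume : Measure I).prod P) := by
  have hmp : MeasurePreserving (Prod.map id Prod.snd : I × (ℕ → I) × Ω → I × Ω)
      ((volume : Measure I).prod ((uniformSeq ℕ).prod P)) ((volume : Measure I).prod P) :=
    (MeasurePreserving.id _).prod measurePreserving_snd
  rw [← hmp.map_eq, integral_map hmp.measurable.aemeasurable
    (hF.measurable_limitRatio hβ hs n r C).aestronglyMeasurable]
  refine integral_congr_ae (ae_of_all _ fun p => ?_)
  simp only [numerU_eq (hC _)]
  rfl

end Limit

/-! ### The invariance equations -/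

/-- The left-hand side of the invariance equations is a density. -/
theorem integral_prod_integral_prod {s : I → I → I → ℝ} (hs : IsField s) {q : ℕ}
    (C : Fin q → Finset ℕ) :
    ∫ p : I × (ℕ → I), ∏ l : Fin q, (∫ u : I, ∏ i ∈ C l, s p.1 u (p.2 i))
        ∂((volume : Measure I).prod (uniformSeq ℕ))
      = homDensity s (((Finset.univ : Finset (Fin q)).sigma C).val.map fun e => ((e.1 : ℕ), e.2)) := by
  set m := ((Finset.univ : Finset (Fin q)).sigma C).val.map fun e => ((e.1 : ℕ), e.2)
  have hm : ∀ w u v, edgeProd s m w u v = ∏ l : Fin q, ∏ i ∈ C l, s w (u l) (v i) := by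
    intro w u v
    rw [edgeProd, Multiset.map_map]
    exact Finset.prod_sigma _ _ _
  have hu : ∀ w v, ∫ u, edgeProd s m w u v ∂(uniformSeq ℕ)
      = ∏ l : Fin q, ∫ u : I, ∏ i ∈ C l, s w u (v i) := by
    intro w v
    simp only [hm]
    exact integral_infinitePi_prod_fin (volume : Measure I) q
      (φ := fun l u => ∏ i ∈ C l, s w u (v i)) fun l =>
        Finset.measurable_prod _ fun i _ => hs.measurable_comp (by fun_prop) (by fun_prop)
          (by fun_prop)
  have hEm : Measurable fun p : (I × (ℕ → I)) × (ℕ → I) => edgeProd s m p.1.1 p.2 p.1.2 :=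
    measurable_edgeProd hs m (by fun_prop) (by fun_prop) (by fun_prop)
  simp only [← hu]
  rw [homDensity, integral_prod, integral_prod]
  rotate_left
  · exact Integrable.of_bound (C := 1) (measurable_edgeProd hs _ (by fun_prop) (by fun_prop)
      (by fun_prop)).aestronglyMeasurable (ae_of_all _ fun a => abs_edgeProd_le hs _ _ _ _)
  · exact Integrable.of_bound (C := 1) (measurable_integral_prod_right hEm).aestronglyMeasurable
      (ae_of_all _ fun p => abs_integral_le_of_abs_le fun u => abs_edgeProd_le hs _ _ _ _)
  refine integral_congr_ae (ae_of_all _ fun w => ?_)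
  dsimp only
  rw [integral_prod_symm]
  exact Integrable.of_bound (C := 1) (measurable_edgeProd hs _ (by fun_prop) (by fun_prop)
    (by fun_prop)).aestronglyMeasurable (ae_of_all _ fun a => abs_edgeProd_le hs _ _ _ _)

/-- Under the invariance equations, the overlaps determine the densities of simple graphs. -/
theorem Invariant.homDensity_eq {β : ℕ → ℝ} (hβ : IsMixture β) {s t : I → I → I → ℝ}
    (hs : IsField s) (ht : IsField t) (hsi : Invariant β s) (hti : Invariant β t)
    (hR : overlapLaw s = overlapLaw t) (S : Finset (ℕ × ℕ)) :
    homDensity s S.val = homDensity t S.val := by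
  classical
  obtain ⟨q, hq⟩ := (S.image Prod.fst).bddAbove
  obtain ⟨n, hn⟩ := (S.image Prod.snd).bddAbove
  -- `C l` is the set of sites joined to replica `l`. As `q` and `n` are attained bounds, `q + 1`
  -- sets and `n + 1` sites are used; replicas without edges get the empty set.
  let C : Fin (q + 1) → Finset ℕ := fun l => (S.image Prod.snd).filter fun i => ((l : ℕ), i) ∈ S
  have hC : ∀ l, C l ⊆ Finset.range (n + 1) := fun l i hi =>
    Finset.mem_range.2 (Nat.lt_succ_of_le (hn (Finset.mem_filter.1 hi).1))
  have hS : S.val = ((Finset.univ : Finset (Fin (q + 1))).sigma C).val.map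
      fun e => ((e.1 : ℕ), e.2) := by
    have hinj : Function.Injective fun e : (Σ _ : Fin (q + 1), ℕ) => ((e.1 : ℕ), e.2) := by
      rintro ⟨a, i⟩ ⟨b, k⟩ hab
      simp only [Prod.mk.injEq] at hab
      obtain ⟨h1, rfl⟩ := hab
      obtain rfl := Fin.ext h1
      rfl
    have : S = ((Finset.univ : Finset (Fin (q + 1))).sigma C).map ⟨_, hinj⟩ := by
      ext ⟨a, i⟩
      simp only [Finset.mem_map, Finset.mem_sigma, Finset.mem_univ, true_and,
        Function.Embedding.coeFn_mk, C, Finset.mem_filter, Finset.mem_image]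
      constructor
      · intro h
        exact ⟨⟨⟨a, Nat.lt_succ_of_le (hq (Finset.mem_coe.2 (Finset.mem_image_of_mem Prod.fst h)))⟩,
          i⟩, ⟨⟨_, h, rfl⟩, h⟩, rfl⟩
      · rintro ⟨e, ⟨-, he⟩, heq⟩
        rw [← heq]
        exact he
    conv_lhs => rw [this]
    rfl
  have key : ∀ {r : I → I → I → ℝ}, IsField r → Invariant β r →
      ∃ (Ω : Type) (_ : MeasurableSpace Ω) (P : Measure Ω) (g h : ℕ → I → I → Ω → ℝ),
        IsProbabilityMeasure P ∧ IsFieldFamily P β r g h ∧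
        homDensity r S.val
          = ∫ p, limitRatio β r g h (n + 1) 1 C p ∂((volume : Measure I).prod P) := by
    rintro r hr ⟨Ω, mΩ, P, g, h, hP, hF, hinv⟩
    refine ⟨Ω, mΩ, P, g, h, hP, hF, ?_⟩
    rw [hS, ← integral_prod_integral_prod hr, ← hF.integral_ratio_eq hβ hr (n + 1) 1 hC]
    -- Equal values of `n` and `m` remove the sites from the right-hand side; `r = 1` is simply the
    -- least value allowed.
    exact hinv (n + 1) (n + 1) (q + 1) 1 (by omega) (by omega) (by omega) le_rfl le_rfl C hC
  obtain ⟨Ω, mΩ, P, g, h, hP, hF, h1⟩ := key hs hsi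
  obtain ⟨Ω', mΩ', P', g', h', hP', hF', h2⟩ := key ht hti
  rw [h1, h2]
  have l1 := hF.tendsto_integral_empiricalRatio hβ hs (Nat.le_add_left 1 n) 1 C
  have l2 := hF'.tendsto_integral_empiricalRatio hβ ht (Nat.le_add_left 1 n) 1 C
  rw [fieldArrayLaw_eq hβ hs ht hF hF' hR] at l1
  exact tendsto_nhds_unique l1 l2

/-! ### Independence of the representing function, and conclusion -/

theorem overlapLaw_bar_eq_of_arrayLaw_eq {σ τ : I → I → I → I → ℝ} (hσ : IsSpinFunction σ)
    (hτ : IsSpinFunction τ) (h : arrayLaw σ = arrayLaw τ) :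
    overlapLaw (bar σ) = overlapLaw (bar τ) := by
  rw [overlapLaw_eq_map_multiOverlapLaw hσ.isField_bar,
    overlapLaw_eq_map_multiOverlapLaw hτ.isField_bar,
    multiOverlapLaw_eq_of_homDensity hσ.isField_bar hτ.isField_bar
      (homDensity_eq_of_arrayLaw_eq hσ hτ h)]

end SKModel

theorem theorem5 (β : ℕ → ℝ) (hβ : SKModel.IsMixture β)
    (μ ν : MeasureTheory.Measure (ℕ → ℕ → ℝ))
    (hμ : μ ∈ SKModel.MInv β) (hν : ν ∈ SKModel.MInv β)
    (σ τ : SKModel.I → SKModel.I → SKModel.I → SKModel.I → ℝ)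
    (hσ : SKModel.Represents σ μ) (hτ : SKModel.Represents τ ν)
    (hR : SKModel.overlapLaw (SKModel.bar σ) = SKModel.overlapLaw (SKModel.bar τ)) :
    μ = ν ∧
      SKModel.multiOverlapLaw (SKModel.bar σ) = SKModel.multiOverlapLaw (SKModel.bar τ) := by
  obtain ⟨σ', ⟨hσ', hσ'μ⟩, hσ'i⟩ := hμ
  obtain ⟨τ', ⟨hτ', hτ'ν⟩, hτ'i⟩ := hν
  obtain ⟨hσ, rfl⟩ := hσ
  obtain ⟨hτ, rfl⟩ := hτ
  -- The invariance equations are known for `σ'` and `τ'`, the equality of overlaps for `σ` and `τ`;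
  -- the law of the array transfers the latter.
  have hR' : SKModel.overlapLaw (SKModel.bar σ') = SKModel.overlapLaw (SKModel.bar τ') := by
    rw [SKModel.overlapLaw_bar_eq_of_arrayLaw_eq hσ' hσ hσ'μ, hR,
      SKModel.overlapLaw_bar_eq_of_arrayLaw_eq hτ' hτ hτ'ν]
  have hlaw : SKModel.arrayLaw σ = SKModel.arrayLaw τ := by
    rw [← hσ'μ, ← hτ'ν]
    exact SKModel.arrayLaw_eq_of_homDensity hσ' hτ'
      (SKModel.Invariant.homDensity_eq hβ hσ'.isField_bar hτ'.isField_bar hσ'i hτ'i hR')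
  exact ⟨hlaw, SKModel.multiOverlapLaw_eq_of_homDensity hσ.isField_bar hτ.isField_bar
    (SKModel.homDensity_eq_of_arrayLaw_eq hσ hτ hlaw)⟩
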